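/- Let $R$ be a discrete valuation ring with uniformizer $\pi$, fraction field $K$ and algebraically closed residue field $\kappa$, and let $0<r<d$ be integers. Let $\Gamma=\{[L_v]\}_v$ be a finite set of homothety classes of $R$-lattices in $K^d$, with representatives $L_v$, which is convex: for all representatives $L,L'$ of members of $\Gamma$ one has $[L\cap L']\in\Gamma$. Put $\overline L_v=L_v/\pi L_v$, let $n_{u,v}$ be the least integer with $\pi^{n_{u,v}}L_u\subset L_v$, and let $f_{u,v}\colon\overline L_u\to\overline L_v$ be the map induced by multiplication by $\pi^{n_{u,v}}$. Assume that $\Gamma$ is locally weakly independent: for each $v\in\Gamma$ there is a subset $I_v\subset\Gamma$ such that for each $u\neq v$ one has $f_{u,v}=f_{w,v}\circ f_{u,w}$ for some $w\in I_v$, and such that the subspaces $\operatorname{im}f_{w,v}=\ker f_{v,w}$ of $\overline L_v$, for $w\in I_v$, are linearly independent. Let $Q(\Gamma)$ be the quiver with vertex set $\Gamma$ and one arrow $u\to v$ for each pair $u\neq v$ such that $f_{u,v}$ is not the composite of the maps $f_{w,w'}$ along a path $u=w_0,w_1,\dots,w_m=v$ with $m\geq 2$ and $w_{i}\neq w_{i+1}$.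 The spaces $\overline L_v$ and the maps $f_{u,v}$ form a representation $M_\Gamma$ of $Q(\Gamma)$. A sub-representation of $M_\Gamma$ is called projective if it is a projective object in the category of those representations of $Q(\Gamma)$ over $\kappa$ that satisfy all linear relations between parallel paths that hold in $M_\Gamma$. Let $LG_r(\Gamma)_0$ be the special fiber of the linked Grassmannian. Its ($\kappa$-)points, with the Zariski topology induced from $\prod_v\mathrm{Gr}(r,\overline L_v)$, are the families $M=(U_v)_v$ of $r$-dimensional subspaces $U_v\subset\overline L_v$ such that, whenever $\pi^kL_u\subset L_v$ with $k\in\mathbb Z$, the map $\overline L_u\to\overline L_v$ induced by $\pi^k$ sends $U_u$ into $U_v$; every such $M$ is a sub-representation of $M_\Gamma$. Let $\Phi(M)=(\dim f_{u,v}(U_u))_{u,v}$ be the rank vector of $M$, and let $\mathcal S_M\subset LG_r(\Gamma)_0$ be the set of all points that are isomorphic to $M$ as representations of $Q(\Gamma)$. Then: 1. the points given by projective sub-representations are dense in $LG_r(\Gamma)_0$; 2. a point $M$ of $LG_r(\Gamma)_0$ is projective if and only if $\Phi(M)$ is a maximal element of the set $\{\Phi(N) : N\in LG_r(\Gamma)_0\}$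 with respect to the componentwise order; 3. the irreducible components of $LG_r(\Gamma)_0$ are exactly the closures $\overline{\mathcal S_M}$ of the strata of the projective points $M$, and non-isomorphic projective points give different components. -/

import Mathlib

open CategoryTheory TensorProduct
open scoped Pointwise

universe u w x

namespace LinkedGrassmannian

/-- The residue field `κ` of the discrete valuation ring `R`. -/
abbrev Kappa (R : Type u) [CommRing R] [IsLocalRing R] : Type u := IsLocalRing.ResidueField R

section Configurations

variable {R : Type u} [CommRing R] {K : Type w} [Field K] [Algebra R K] {d : ℕ} {ι : Type x}

/-- Two `R`-submodules of `K ^ d` are homothetic if they differ by a nonzero scalar of `K`. -/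
def Homothetic (L L' : Submodule R (Fin d → K)) : Prop :=
  ∃ a : K, a ≠ 0 ∧ L' = a • L

variable (R K d ι) in
/-- A family, indexed by `ι`, of pairwise distinct homothety classes of lattices in `K ^ d`,
with chosen representatives `L i`. -/
structure Configuration where
  /-- the chosen representatives -/
  L : ι → Submodule R (Fin d → K)
  isLattice : ∀ i, Submodule.IsLattice K (L i)
  eq_of_homothetic : ∀ i j, Homothetic (L i) (L j) → i = j

/-- A configuration is convex if the class of the intersection of any representatives of two
of its members is again a member. -/
def Configuration.IsConvex (Γ : Configuration R K d ι) : Prop :=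
  ∀ (i j : ι) (a b : K), a ≠ 0 → b ≠ 0 → ∃ k, Homothetic (Γ.L k) (a • Γ.L i ⊓ b • Γ.L j)

/-- The (possibly negative) power `ϖ ^ n`, as an element of `K`. -/
def piPow (K : Type w) [Field K] [Algebra R K] (ϖ : R) (n : ℤ) : K := (algebraMap R K ϖ) ^ n

/-- Multiplication by `c ∈ K`, as a map `L → L'` between submodules with `c L ⊆ L'`. -/
def mulMap (c : K) {L L' : Submodule R (Fin d → K)} (h : c • L ≤ L') : L →ₗ[R] L' :=
  (DistribSMul.toLinearMap R (Fin d → K) c).restrict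
    fun v hv => h (Submodule.smul_mem_pointwise_smul v c L hv)

/-- `n i j` is the smallest integer `n` with `ϖ ^ n L i ⊆ L j`. -/
noncomputable def exponent (ϖ : R) (Γ : Configuration R K d ι) (i j : ι) : ℤ :=
  sInf {n : ℤ | piPow K ϖ n • Γ.L i ≤ Γ.L j}

theorem exists_pow_smul_le [IsDomain R] [IsDiscreteValuationRing R] [IsFractionRing R K]
    {ϖ : R} (hϖ : Irreducible ϖ) (L L' : Submodule R (Fin d → K))
    (hL : Submodule.IsLattice K L) (hL' : Submodule.IsLattice K L') :
    ∃ n : ℕ, ∀ y ∈ L, piPow K ϖ n • y ∈ L' := by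
  have hmul : ∀ (n : ℕ) (y : Fin d → K), piPow K ϖ n • y = ϖ ^ n • y := by
    intro n y
    rw [← algebraMap_smul K (ϖ ^ n) y, map_pow]
    simp [piPow]
  simp only [hmul]
  have hpt : ∀ y : Fin d → K, ∃ n : ℕ, ϖ ^ n • y ∈ L' := by
    intro y
    have hy : y ∈ Submodule.span K (L' : Set (Fin d → K)) := by
      rw [hL'.span_eq_top]; trivial
    induction hy using Submodule.span_induction with
    | mem z hz => exact ⟨0, by simpa using hz⟩
    | zero => exact ⟨0, by simp⟩
    | add a b _ _ ha hb =>
      obtain ⟨n, hn⟩ := ha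
      obtain ⟨m, hm⟩ := hb
      refine ⟨n + m, ?_⟩
      rw [smul_add]
      refine L'.add_mem ?_ ?_
      · rw [add_comm, pow_add, mul_smul]; exact L'.smul_mem _ hn
      · rw [pow_add, mul_smul]; exact L'.smul_mem _ hm
    | smul c a _ ha =>
      obtain ⟨n, hn⟩ := ha
      obtain ⟨p, q, hq, rfl⟩ := IsFractionRing.div_surjective (A := R) c
      have hq0 : q ≠ 0 := nonZeroDivisors.ne_zero hq
      obtain ⟨m, v, rfl⟩ := IsDiscreteValuationRing.eq_unit_mul_pow_irreducible hq0 hϖ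
      have hq1 : algebraMap R K ((v : R) * ϖ ^ m) ≠ 0 := by simpa using hq0
      refine ⟨n + m, ?_⟩
      have : ϖ ^ (n + m) • (algebraMap R K p / algebraMap R K (↑v * ϖ ^ m)) • a
          = ((v⁻¹ : Rˣ) * p : R) • (ϖ ^ n • a) := by
        rw [smul_smul _ _ a, ← algebraMap_smul K (ϖ ^ (n + m)), smul_smul,
          ← algebraMap_smul K ((v⁻¹ : Rˣ) * p * ϖ ^ n : R)]
        congr 1
        rw [mul_div_assoc', div_eq_iff hq1, ← map_mul, ← map_mul]
        congr 1
        have : ((v⁻¹ : Rˣ) : R) * v = 1 := by simp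
        linear_combination (-(p * ϖ ^ (n + m))) * this
      rw [this]
      exact L'.smul_mem _ hn
  refine Submodule.fg_induction
    (motive := fun N _ => ∃ n : ℕ, ∀ y ∈ N, ϖ ^ n • y ∈ L') ?_ ?_ L hL.fg
  · intro y
    obtain ⟨n, hn⟩ := hpt y
    refine ⟨n, fun z hz => ?_⟩
    obtain ⟨a, rfl⟩ := Submodule.mem_span_singleton.1 hz
    rw [smul_comm]
    exact L'.smul_mem _ hn
  · rintro N₁ N₂ - - ⟨n, hn⟩ ⟨m, hm⟩
    refine ⟨n + m, fun z hz => ?_⟩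
    obtain ⟨a, ha, b, hb, rfl⟩ := Submodule.mem_sup.1 hz
    rw [smul_add]
    refine L'.add_mem ?_ ?_
    · rw [add_comm, pow_add, mul_smul]; exact L'.smul_mem _ (hn _ ha)
    · rw [pow_add, mul_smul]; exact L'.smul_mem _ (hm _ hb)

/-- The integer `exponent ϖ Γ i j` really is the least one (when `d > 0`). -/
theorem exponent_isLeast [IsDomain R] [IsDiscreteValuationRing R] [IsFractionRing R K]
    {ϖ : R} (hϖ : Irreducible ϖ) (hd : 0 < d) (Γ : Configuration R K d ι) (i j : ι) :
    IsLeast {n : ℤ | piPow K ϖ n • Γ.L i ≤ Γ.L j} (exponent ϖ Γ i j) := by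
  obtain ⟨n, hn⟩ := exists_pow_smul_le hϖ (Γ.L i) (Γ.L j) (Γ.isLattice i) (Γ.isLattice j)
  obtain ⟨m, hm⟩ := exists_pow_smul_le hϖ (Γ.L j) (Γ.L i) (Γ.isLattice j) (Γ.isLattice i)
  have hne : {n : ℤ | piPow K ϖ n • Γ.L i ≤ Γ.L j}.Nonempty :=
    ⟨n, fun y hy => by
      obtain ⟨z, hz, rfl⟩ := (Submodule.mem_smul_pointwise_iff_exists _ _ _).1 hy
      exact hn z hz⟩
  have h0 : algebraMap R K ϖ ≠ 0 := by
    simpa using hϖ.ne_zero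
  have hbdd : BddBelow {n : ℤ | piPow K ϖ n • Γ.L i ≤ Γ.L j} := by
    refine ⟨-(m : ℤ), fun k hk => ?_⟩
    by_contra! hlt
    obtain ⟨e, he⟩ : ∃ e : ℕ, -(m : ℤ) - k = e + 1 := ⟨(-(m : ℤ) - k - 1).toNat, by omega⟩
    have key : ∀ y ∈ Γ.L i, y ∈ Ideal.span {ϖ} • Γ.L i := by
      intro y hy
      have h1 : piPow K ϖ m • piPow K ϖ k • y ∈ Γ.L i :=
        hm _ (hk (Submodule.smul_mem_pointwise_smul y _ _ hy))
      have h2 : y = ϖ • (ϖ ^ e • (piPow K ϖ m • piPow K ϖ k • y)) := by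
        rw [smul_smul ϖ, ← pow_succ', smul_smul (piPow K ϖ m),
          ← algebraMap_smul K (ϖ ^ (e + 1)), smul_smul]
        have : algebraMap R K (ϖ ^ (e + 1)) * (piPow K ϖ m * piPow K ϖ k) = 1 := by
          unfold piPow
          rw [map_pow, ← zpow_natCast, ← zpow_add₀ h0, ← zpow_add₀ h0]
          have : ((e + 1 : ℕ) : ℤ) + ((m : ℤ) + k) = 0 := by push_cast; omega
          rw [this, zpow_zero]
        rw [this, one_smul]
      rw [h2]
      exact Submodule.smul_mem_smul (Ideal.mem_span_singleton_self ϖ)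
        ((Γ.L i).smul_mem _ h1)
    have hbot : Γ.L i = ⊥ := by
      refine Submodule.eq_bot_of_le_smul_of_le_jacobson_bot (Ideal.span {ϖ}) _
        (Γ.isLattice i).fg key ?_
      rw [IsLocalRing.jacobson_eq_maximalIdeal ⊥ bot_ne_top, hϖ.maximalIdeal_eq]
    have htop := (Γ.isLattice i).span_eq_top
    rw [hbot] at htop
    have : Nonempty (Fin d) := ⟨⟨0, hd⟩⟩
    simp at htop
  exact ⟨Int.csInf_mem hne hbdd, fun k hk => csInf_le hbdd hk⟩

open Classical in
/-- The map `F i j : L i → L j`, multiplication by `ϖ ^ n i j`. (By `exponent_isLeast` the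
second case does not occur.) -/
noncomputable def bigF (ϖ : R) (Γ : Configuration R K d ι) (i j : ι) : Γ.L i →ₗ[R] Γ.L j :=
  if h : piPow K ϖ (exponent ϖ Γ i j) • Γ.L i ≤ Γ.L j then
    mulMap (piPow K ϖ (exponent ϖ Γ i j)) h
  else 0

variable [IsLocalRing R]

/-- The reduction `κ ⊗ L i`, canonically `L i / ϖ L i`. -/
abbrev Configuration.Lbar (Γ : Configuration R K d ι) (i : ι) : Type (max u w) :=
  Kappa R ⊗[R] Γ.L i

/-- The map `f i j` between the reductions of `L i` and `L j` induced by `F i j`. -/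
noncomputable def smallF (ϖ : R) (Γ : Configuration R K d ι) (i j : ι) :
    Γ.Lbar i →ₗ[Kappa R] Γ.Lbar j :=
  (bigF ϖ Γ i j).baseChange (Kappa R)

/-- Local weak independence at `v`. (The equality of image and kernel excludes `v ∈ I`.) -/
def IsLocallyWeaklyIndependentAt (ϖ : R) (Γ : Configuration R K d ι) (v : ι) : Prop :=
  ∃ I : Set ι,
    (∀ u, u ≠ v → ∃ w ∈ I, smallF ϖ Γ u v = smallF ϖ Γ w v ∘ₗ smallF ϖ Γ u w) ∧
    (∀ w ∈ I, LinearMap.range (smallF ϖ Γ w v) = LinearMap.ker (smallF ϖ Γ v w)) ∧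
    iSupIndep fun w : I => LinearMap.range (smallF ϖ Γ w v)

/-- Locally weakly independent lattice configurations. -/
structure IsLocallyWeaklyIndependent (ϖ : R) (Γ : Configuration R K d ι) : Prop where
  convex : Γ.IsConvex
  indep : ∀ v, IsLocallyWeaklyIndependentAt ϖ Γ v

/-! ### The quiver of a configuration and its representations -/

/-- The vertices of the quiver `Q'`, which has exactly one arrow `i ⟶ j` for all `i ≠ j`. -/
def FullVertex (_ : Configuration R K d ι) : Type x := ι

instance (Γ : Configuration R K d ι) : Quiver (FullVertex Γ) where
  Hom i j := PLift (i ≠ j)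

/-- The composite of the maps `f` along a path of `Q'`. -/
noncomputable def pathMap (ϖ : R) (Γ : Configuration R K d ι) (i : ι) :
    (j : ι) → Quiver.Path (V := FullVertex Γ) i j → (Γ.Lbar i →ₗ[Kappa R] Γ.Lbar j)
  | _, .nil => LinearMap.id
  | _, .cons (b := b) (c := c) p _ => smallF ϖ Γ b c ∘ₗ pathMap ϖ Γ i b p

/-- The vertices of the quiver `Q` of the configuration. -/
def Vertex (_ : R) (_ : Configuration R K d ι) : Type x := ι

/-- The arrows of `Q` are those arrows `i ⟶ j` of `Q'` for which `f i j` is not the composite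
along a path of `Q'` of length at least two. -/
instance (ϖ : R) (Γ : Configuration R K d ι) : Quiver (Vertex ϖ Γ) where
  Hom i j := PLift (i ≠ j ∧
    ¬ ∃ p : Quiver.Path (V := FullVertex Γ) i j, 2 ≤ p.length ∧ pathMap ϖ Γ i j p = smallF ϖ Γ i j)

/-- Representations of the quiver `Q` over `κ`. -/
abbrev QuiverRep (ϖ : R) (Γ : Configuration R K d ι) :=
  Paths (Vertex ϖ Γ) ⥤ ModuleCat.{max u w} (Kappa R)

/-- The representation `M_Γ`, formed by the reductions of the lattices and the maps `f i j`. -/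
noncomputable def ambientRep (ϖ : R) (Γ : Configuration R K d ι) : QuiverRep ϖ Γ :=
  Paths.lift
    { obj := fun i => ModuleCat.of (Kappa R) (Γ.Lbar i)
      map := fun {i j} _ => ModuleCat.ofHom (smallF ϖ Γ i j) }

/-- A representation satisfies the relations of `M_Γ` if every linear combination of parallel
paths that acts as zero on `M_Γ` acts as zero on it. -/
def satisfiesRelations (ϖ : R) (Γ : Configuration R K d ι) : ObjectProperty (QuiverRep ϖ Γ) :=
  fun N => ∀ (i j : Paths (Vertex ϖ Γ)) (c : (i ⟶ j) →₀ Kappa R),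
    (c.sum fun p a => a • (ambientRep ϖ Γ).map p) = 0 → (c.sum fun p a => a • N.map p) = 0

/-- The category of representations of the bound quiver (`Q` with the relations of `M_Γ`). -/
abbrev BoundRep (ϖ : R) (Γ : Configuration R K d ι) := (satisfiesRelations ϖ Γ).FullSubcategory

/-! ### The special fiber of the linked Grassmannian -/

/-- A `κ`-point of the special fiber of the linked Grassmannian `LG_r(Γ)`: for every `i` an
`r`-dimensional subspace `E i` of `κ ⊗ L i`, such that for every inclusion
`ϖ ^ k : L i → L j` (`k` any integer) the induced map sends `E i` into `E j`. -/
@[ext]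
structure SpecialFiber (ϖ : R) (Γ : Configuration R K d ι) (r : ℕ) where
  /-- the subspaces -/
  E : ∀ i, Submodule (Kappa R) (Γ.Lbar i)
  finrank_eq : ∀ i, Module.finrank (Kappa R) (E i) = r
  compat : ∀ (i j : ι) (k : ℤ) (h : piPow K ϖ k • Γ.L i ≤ Γ.L j),
    ∀ y ∈ E i, (mulMap (piPow K ϖ k) h).baseChange (Kappa R) y ∈ E j

namespace SpecialFiber

variable {ϖ : R} {Γ : Configuration R K d ι} {r : ℕ}

theorem smallF_mem (M : SpecialFiber ϖ Γ r) (i j : ι) (y : Γ.Lbar i) (hy : y ∈ M.E i) :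
    smallF ϖ Γ i j y ∈ M.E j := by
  unfold smallF bigF
  split_ifs with h
  · exact M.compat i j _ h y hy
  · simp

/-- The sub-representation of `M_Γ` given by a point of the special fiber. -/
noncomputable def rep (M : SpecialFiber ϖ Γ r) : QuiverRep ϖ Γ :=
  Paths.lift
    { obj := fun i => ModuleCat.of (Kappa R) (M.E i)
      map := fun {i j} _ => ModuleCat.ofHom ((smallF ϖ Γ i j).restrict (M.smallF_mem i j)) }

/-- The inclusion of a sub-representation into `M_Γ`. -/
noncomputable def incl (M : SpecialFiber ϖ Γ r) : M.rep ⟶ ambientRep ϖ Γ :=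
  Paths.liftNatTrans (fun i => ModuleCat.ofHom (M.E i).subtype) fun {i j} e => by
    simp only [rep, ambientRep, Paths.lift_toPath]
    rfl

theorem satisfiesRelations_rep (M : SpecialFiber ϖ Γ r) : satisfiesRelations ϖ Γ M.rep := by
  intro i j c hc
  have hmono : Mono (M.incl.app j) :=
    (ModuleCat.mono_iff_injective _).2 (M.E j).injective_subtype
  rw [← cancel_mono (M.incl.app j), Limits.zero_comp, Finsupp.sum, Preadditive.sum_comp]
  simp only [Linear.smul_comp, NatTrans.naturality]
  simp only [← Linear.comp_smul]
  rw [← Preadditive.comp_sum]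
  rw [Finsupp.sum] at hc
  rw [hc, Limits.comp_zero]

/-- The sub-representation given by a point, as a representation with relations. -/
noncomputable def boundRep (M : SpecialFiber ϖ Γ r) : BoundRep ϖ Γ :=
  ⟨M.rep, M.satisfiesRelations_rep⟩

/-- The point is projective: its sub-representation is a projective object of the category of
representations of `Q` satisfying the relations of `M_Γ`. -/
def IsProjective (M : SpecialFiber ϖ Γ r) : Prop := Projective M.boundRep

/-- The rank vector `(dim f i j (E i))` of a point. -/
noncomputable def rankVector (M : SpecialFiber ϖ Γ r) : ι → ι → ℕ :=
  fun i j => Module.finrank (Kappa R) ((M.E i).map (smallF ϖ Γ i j))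

/-- The quiver stratum of `M`: all points whose sub-representation is isomorphic to that of
`M`. -/
def stratum (M : SpecialFiber ϖ Γ r) : Set (SpecialFiber ϖ Γ r) :=
  {N | Nonempty (N.rep ≅ M.rep)}

variable (ϖ Γ r) in
/-- Points of the special fiber together with a basis of each of the subspaces. Over the
special fiber this is a Zariski locally trivial principal bundle with group `∏ i, GL_r`. -/
structure Framed where
  /-- the underlying point of the special fiber -/
  point : SpecialFiber ϖ Γ r
  /-- the bases of the subspaces -/
  basis : ∀ i, Module.Basis (Fin r) (Kappa R) (point.E i)

/-- All the linear coordinates of a framed point: the values of all linear forms on `κ ⊗ L i`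
at the vectors of the basis of `E i`. -/
noncomputable def Framed.coord (b : Framed ϖ Γ r) :
    (Σ i, Fin r × Module.Dual (Kappa R) (Γ.Lbar i)) → Kappa R :=
  fun s => s.2.2 (b.basis s.1 s.2.1)

/-- The Zariski topology on the space of framed points, a locally closed subset of the
affine space `∏ i, (κ ⊗ L i) ^ r`: the closed sets are the zero loci of polynomials in the
linear coordinates. -/
noncomputable instance : TopologicalSpace (Framed ϖ Γ r) :=
  TopologicalSpace.induced
    (fun b => (MvPolynomial.pointToPoint (k := Kappa R) b.coord :
      PrimeSpectrum (MvPolynomial _ (Kappa R)))) inferInstance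

/-- The Zariski topology on the special fiber, a closed subvariety of the product of the
Grassmannians `Gr(r, κ ⊗ L i)`: the quotient topology from the space of framed points. -/
noncomputable instance : TopologicalSpace (SpecialFiber ϖ Γ r) :=
  TopologicalSpace.coinduced Framed.point inferInstance

/-- Explicit form of the topology: a set of points is closed if and only if membership in it is
given by the vanishing of polynomials in the coordinates of a basis of the subspaces. -/
theorem isClosed_iff (Z : Set (SpecialFiber ϖ Γ r)) :
    IsClosed Z ↔ ∃ S : Set (MvPolynomial
        (Σ i, Fin r × Module.Dual (Kappa R) (Γ.Lbar i)) (Kappa R)),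
      ∀ b : Framed ϖ Γ r, b.point ∈ Z ↔ ∀ p ∈ S, MvPolynomial.eval b.coord p = 0 := by
  rw [isClosed_coinduced, isClosed_induced_iff]
  constructor
  · rintro ⟨t, ht, h⟩
    obtain ⟨s, rfl⟩ := (PrimeSpectrum.isClosed_iff_zeroLocus _).1 ht
    refine ⟨s, fun b => ?_⟩
    have := Set.ext_iff.1 h b
    simp only [Set.mem_preimage] at this
    rw [← this]
    simp [PrimeSpectrum.mem_zeroLocus, MvPolynomial.pointToPoint, Set.subset_def,
      MvPolynomial.mem_vanishingIdeal_iff, MvPolynomial.aeval_eq_eval]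
  · rintro ⟨s, h⟩
    refine ⟨PrimeSpectrum.zeroLocus s, PrimeSpectrum.isClosed_zeroLocus s, ?_⟩
    ext b
    simp [h, PrimeSpectrum.mem_zeroLocus, MvPolynomial.pointToPoint, Set.subset_def,
      MvPolynomial.mem_vanishingIdeal_iff, MvPolynomial.aeval_eq_eval]

end SpecialFiber

end Configurations

end LinkedGrassmannian

/-! Write `n u v` for the exponents and say that `v` lies between `u` and `w` if `n u w = n u v + n
v w`. By minimality of the exponents, `f v w ∘ f u v` is `f u w` if `v` lies between `u` and `w`,
and zero otherwise. Independence of the images makes the last arrow of a path from `u` to `v`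
unique, and convexity gives `n w v + n v w = 1` for `w ∈ I v` (`exponent_add_eq_one`). What remains
is linear algebra over this combinatorial structure (`IsLinked`).

The key notion is exactness: for every arrow `w ⟶ v`, the kernel of `f w v` on `U w` is `f v w (U
v)`. An exact point has generators whose images form a basis at every vertex
(`IsLinked.exists_isAdapted`), so it is a sum of indecomposable projectives, one for each generator;
conversely, splitting a cover by such projectives shows that projective points are exact
(`IsProjective.isExact`). The numbers `t u` of generators determine the isomorphism class and the
rank vector. A point whose ranks are at least those of an exact point is exact with the same `t`, by
rank-nullity (`IsAdapted.of_rank_le`).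

If a point is not exact, some `x` in `U i` is killed on the way around a cycle of total exponent one
without coming from the preceding vertices. Since all dimensions are equal, there is a direction `ξ`
in which moving `x` raises a rank, and the motion extends to a line of points
(`exists_deformation`). Ranks are lower semicontinuous and `κ` is infinite, so the point is a limit
of points with larger rank vector. Induction on the rank deficit gives density, and with it the
maximality criterion.

Points with generators of a fixed type form an irreducible set, since two of them are joined by a
line whose generic member has the same type. There are finitely many types, so the closures of the
projective strata form a finite cover by irreducible closed sets; semicontinuity of ranks excludes
inclusions between different ones. -/

namespace LinkedGrassmannian

/-! ### Combinatorics of the exponents -/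

/-- Integers `n u v` which behave like the exponents of a locally weakly independent
configuration, where `I v` is the set of the vertices `w` with an arrow `w ⟶ v`. A vertex `v` lies
between `u` and `w` if `n u w = n u v + n v w`. -/
structure IsArrowSystem {ι : Type*} (n : ι → ι → ℤ) (I : ι → Set ι) : Prop where
  self : ∀ u, n u u = 0
  tri : ∀ u v w, n u w ≤ n u v + n v w
  pos : ∀ {u v}, u ≠ v → 0 < n u v + n v u
  pred : ∀ {u v}, u ≠ v → ∃ w ∈ I v, n u v = n u w + n w v
  uniq : ∀ {u v w w'}, w ∈ I v → w' ∈ I v → n u v = n u w + n w v →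
    n u v = n u w' + n w' v → w = w'
  adj : ∀ {v w}, w ∈ I v → n w v + n v w = 1

namespace IsArrowSystem

variable {ι : Type*} {n : ι → ι → ℤ} {I : ι → Set ι}

theorem ne_of_mem (h : IsArrowSystem n I) {v w : ι} (hw : w ∈ I v) : w ≠ v := by
  rintro rfl
  have := h.adj hw
  have := h.self w
  omega

theorem eq_of_add_nonpos (h : IsArrowSystem n I) {u v : ι} (huv : n u v + n v u ≤ 0) : u = v := by
  by_contra hne
  have := h.pos hne
  omega

/-- The defects of the two triangle inequalities are nonnegative integers with sum `n a b + n b a =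
1`, so one of them vanishes. -/
theorem dichotomy_in (h : IsArrowSystem n I) {a b : ι} (hab : n a b + n b a = 1) (z : ι) :
    n z b = n z a + n a b ∨ n z a = n z b + n b a := by
  have := h.tri z a b
  have := h.tri z b a
  omega

theorem dichotomy_out (h : IsArrowSystem n I) {a b : ι} (hab : n a b + n b a = 1) (z : ι) :
    n a z = n a b + n b z ∨ n b z = n b a + n a z := by
  have := h.tri a b z
  have := h.tri b a z
  omega

/-- Induction along the paths starting at `z`. -/
theorem path_induction [Finite ι] (h : IsArrowSystem n I) (z : ι) {motive : ι → Prop}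
    (step : ∀ p, (∀ w, w ≠ p → n z p = n z w + n w p → motive w) → motive p) (p : ι) :
    motive p := by
  let r : ι → ι → Prop := fun w p => w ≠ p ∧ n z p = n z w + n w p
  have : IsTrans ι r := ⟨fun a b c hab hbc => by
    have t1 := h.tri z a c
    have t2 := h.tri a b c
    refine ⟨?_, by have := hab.2; have := hbc.2; omega⟩
    rintro rfl
    have := h.pos hab.1
    have := hab.2
    have := hbc.2
    omega⟩
  have : Std.Irrefl r := ⟨fun a ha => ha.1 rfl⟩
  exact (Finite.wellFounded_of_trans_of_irrefl r).induction p
    fun p ih => step p fun w hw hp => ih w ⟨hw, hp⟩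

/-- Induction along the paths ending at `z`, starting with the longest ones. -/
theorem path_induction_rev [Finite ι] (h : IsArrowSystem n I) (z : ι) {motive : ι → Prop}
    (step : ∀ p, (∀ w, w ≠ p → n w z = n w p + n p z → motive w) → motive p) (p : ι) :
    motive p := by
  let r : ι → ι → Prop := fun w p => w ≠ p ∧ n w z = n w p + n p z
  have : IsTrans ι r := ⟨fun a b c hab hbc => by
    have t1 := h.tri a c z
    have t2 := h.tri a b c
    refine ⟨?_, by have := hab.2; have := hbc.2; omega⟩
    rintro rfl
    have := h.pos hab.1
    have := hab.2
    have := hbc.2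
    omega⟩
  have : Std.Irrefl r := ⟨fun a ha => ha.1 rfl⟩
  exact (Finite.wellFounded_of_trans_of_irrefl r).induction p
    fun p ih => step p fun w hw hp => ih w ⟨hw, hp⟩

/-- The vertices between `z` and `p` are linearly ordered. -/
theorem chain [Finite ι] (h : IsArrowSystem n I) {z a b p : ι}
    (ha : n z p = n z a + n a p) (hb : n z p = n z b + n b p) :
    n a p = n a b + n b p ∨ n b p = n b a + n a p := by
  revert ha hb
  refine h.path_induction z (motive := fun p => n z p = n z a + n a p → n z p = n z b + n b p →
    n a p = n a b + n b p ∨ n b p = n b a + n a p) (fun p ih ha hb => ?_) p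
  have hs := h.self p
  rcases eq_or_ne a p with rfl | hap
  · right; omega
  rcases eq_or_ne b p with rfl | hbp
  · left; omega
  obtain ⟨w, hw, hwa⟩ := h.pred hap
  obtain ⟨w', hw', hwb⟩ := h.pred hbp
  have h1 := h.tri z a w
  have h2 := h.tri z w p
  have h3 := h.tri z b w'
  have h4 := h.tri z w' p
  -- The last arrows of the paths from `a` and from `b` are both last arrows of a path from `z`,
  -- hence equal; now shorten the path.
  obtain rfl : w = w' := h.uniq (u := z) hw hw' (by omega) (by omega)
  have h5 := h.tri a b p
  have h6 := h.tri b a p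
  rcases ih w (h.ne_of_mem hw) (by omega) (by omega) (by omega) with h' | h'
  · left; omega
  · right; omega

/-- If `q ≠ b`, the last arrow from `q` to `b` is also the last one from `a`, so it starts at `a`;
then `a` and `q` lie on each other's paths and coincide. -/
theorem eq_or_eq_of_between (h : IsArrowSystem n I) {a b q : ι} (hab : a ∈ I b)
    (hq : n a b = n a q + n q b) : q = a ∨ q = b := by
  by_contra! hne
  obtain ⟨c, hc, hqc⟩ := h.pred hne.2
  have h1 := h.tri a q c
  have h2 := h.tri a c b
  have h3 := h.self a
  obtain rfl : c = a := h.uniq (u := a) hc hab (by omega) (by omega)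
  exact hne.1 (h.eq_of_add_nonpos (by omega))

/-- A cycle `v ⟶ ⋯ ⟶ h ⟶ i ⟶ ⋯ ⟶ j ⟶ v` in which `h ⟶ i` and `j ⟶ v` are arrows. -/
structure IsCycle (n : ι → ι → ℤ) (I : ι → Set ι) (v h i j : ι) : Prop where
  mem : h ∈ I i
  mem' : j ∈ I v
  sum_eq : n v h + n h i + n i j + n j v = 1

theorem IsCycle.between [Finite ι] (H : IsArrowSystem n I) {v h i j : ι}
    (C : IsCycle n I v h i j) {z u : ι}
    (hz : n z j = n z h + n h i + n i j) (hu : n v u = n v i + n i u) :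
    n z u = n z i + n i u := by
  revert hu
  refine H.path_induction i (motive := fun u => n v u = n v i + n i u → n z u = n z i + n i u)
    (fun q ih hq => ?_) u
  have hself := H.self
  rcases eq_or_ne i q with rfl | hiq
  · simp [hself]
  obtain ⟨p, hp, hip⟩ := H.pred hiq
  have hvp : n v p = n v i + n i p := by
    have := H.tri v i p
    have := H.tri v p q
    omega
  have hzp := ih p (H.ne_of_mem hp) hip hvp
  rcases H.dichotomy_in (H.adj hp) z with h1 | h1
  · omega
  -- The path from `z` to `p` now passes through `q`, although `q` comes after `p` on the path from
  -- `i`. Linear order of the vertices between two given ones puts `q` before `i`, and then before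
  -- `h`. Both positions of `q` relative to the arrow `j ⟶ v` contradict the total exponent one of
  -- the cycle.
  exfalso
  have hadj := H.adj hp
  have hqv : q ≠ v := by
    rintro rfl
    have := H.self q
    have := H.pos hiq
    omega
  have cyc := C.sum_eq
  have ajv := H.adj C.mem'
  have ahi := H.adj C.mem
  have t1 := H.tri v h i
  have t2 := H.tri v i j
  have t3 := H.tri i j v
  have hiv : i ≠ v := by
    rintro rfl
    have := H.pos (H.ne_of_mem C.mem)
    have := H.tri i j i
    have := H.self i
    omega
  have t4 := H.pos hiv
  -- `q` lies between `z` and `i`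
  have hqi : n z i = n z q + n q i ∧ n q p = n q i + n i p := by
    rcases H.chain (z := z) (a := i) (b := q) (p := p) hzp h1 with h2 | h2
    · omega
    · have := H.tri z q i
      have := H.tri z i p
      omega
  obtain ⟨hzq, hqp⟩ := hqi
  have t5 := H.tri z h i
  have t6 := H.tri z i j
  have hqh : n q i = n q h + n h i := by
    rcases H.chain (z := z) (a := h) (b := q) (p := i) (by omega) hzq with h2 | h2
    · rcases H.eq_or_eq_of_between C.mem h2 with rfl | rfl
      · simp [hself]
      · exact absurd rfl hiq
    · exact h2
  have t7 := H.tri q i j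
  have t8 := H.tri z q j
  have hqj : n q j = n q i + n i j := by omega
  have t9 := H.tri i v h
  have t10 := H.pos (H.ne_of_mem C.mem)
  rcases H.dichotomy_in ajv q with h2 | h2
  · have t11 := H.tri i q h
    have t12 := H.tri h i h
    have := H.tri i h i
    rcases H.chain (z := i) (a := v) (b := q) (p := h) (by omega) (by omega) with h3 | h3
    · have := H.tri i v q
      have := H.tri i q v
      omega
    · have := H.tri i v q
      have := H.tri i q v
      omega
  · have t11 := H.tri q v i
    have t12 := H.tri i q v
    have t13 := H.tri i v q
    rcases H.chain (z := i) (a := q) (b := j) (p := v) (by omega) (by omega) with h3 | h3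
    · omega
    · rcases H.eq_or_eq_of_between C.mem' h3 with rfl | rfl
      · simp only [hself] at *
        omega
      · exact hqv rfl

end IsArrowSystem

/-! ### Linked systems of vector spaces -/

section LinkedSystems

variable {k : Type*} [Field k] {ι : Type*} {V : ι → Type*} [∀ u, AddCommGroup (V u)]
  [∀ u, Module k (V u)]

/-- Vector spaces and maps which behave like the reductions of a locally weakly independent
configuration. -/
structure IsLinked (f : ∀ u v, V u →ₗ[k] V v) (n : ι → ι → ℤ) (I : ι → Set ι) : Prop
    extends IsArrowSystem n I where
  map_self : ∀ u y, f u u y = y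
  map_map : ∀ {u v w}, n u w = n u v + n v w → ∀ y, f v w (f u v y) = f u w y
  map_map_eq_zero : ∀ {u v w}, n u w ≠ n u v + n v w → ∀ y, f v w (f u v y) = 0
  exact : ∀ {u v}, n u v + n v u = 1 → ∀ y, f u v y = 0 → ∃ z, f v u z = y
  indep : ∀ v, iSupIndep fun w : I v => LinearMap.range (f w v)
  ne_zero : ∀ u v, f u v ≠ 0

/-- Families of subspaces which are stable under the maps of the system. -/
def IsStable (f : ∀ u v, V u →ₗ[k] V v) (U : ∀ u, Submodule k (V u)) : Prop :=
  ∀ u v, ∀ y ∈ U u, f u v y ∈ U v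

/-- Exactness of a stable family of subspaces at the sources of the arrows. -/
def IsExact (f : ∀ u v, V u →ₗ[k] V v) (I : ι → Set ι) (U : ∀ u, Submodule k (V u)) : Prop :=
  ∀ v, ∀ w ∈ I v, ∀ y ∈ U w, f w v y = 0 → ∃ z ∈ U v, f v w z = y

/-- A system of generators `e` of the family `U`, with `t u` elements at the vertex `u`, such that
their images at each vertex form a basis. -/
structure IsAdapted (f : ∀ u v, V u →ₗ[k] V v) (U : ∀ u, Submodule k (V u)) {t : ι → ℕ}
    (e : ∀ s : (Σ u, Fin (t u)), V s.1) : Prop where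
  indep : ∀ v, LinearIndependent k fun s => f s.1 v (e s)
  span : ∀ v, Submodule.span k (Set.range fun s => f s.1 v (e s)) = U v

namespace IsLinked

variable {f : ∀ u v, V u →ₗ[k] V v} {n : ι → ι → ℤ} {I : ι → Set ι}

open Classical in
theorem map_map_ite (H : IsLinked f n I) (u v w : ι) (y : V u) :
    f v w (f u v y) = if n u w = n u v + n v w then f u w y else 0 := by
  split_ifs with h
  · exact H.map_map h y
  · exact H.map_map_eq_zero h y

theorem isExact_top (H : IsLinked f n I) : IsExact f I fun u => (⊤ : Submodule k (V u)) := by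
  intro v w hw y _ hy
  obtain ⟨z, hz⟩ := H.exact (H.adj hw) y hy
  exact ⟨z, trivial, hz⟩

/-- Elements of the images of distinct arrows with target `v`, and their independence. -/
theorem eq_zero_of_sum_eq_zero [Fintype ι] (H : IsLinked f n I) (v : ι) [DecidablePred (· ∈ I v)]
    (y : ∀ u, V u) (hy : ∑ w with w ∈ I v, f w v (y w) = 0) {w : ι} (hw : w ∈ I v) :
    f w v (y w) = 0 := by
  have := (iSupIndep_iff_finsetSum_eq_zero_imp_eq_zero _).1 (H.indep v) Finset.univ
    (fun w => f w v (y w)) (fun w _ => ⟨_, rfl⟩) ?_ ⟨w, hw⟩ (Finset.mem_univ _)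
  · exact this
  · rw [← hy, Finset.sum_subtype _ (p := (· ∈ I v)) (by simp)]

/-- The generators at `v` are a basis of a complement of the radical, the part of `U v` that arrives
along arrows. Spanning is a Nakayama argument along paths; independence is where exactness is
needed. -/
theorem exists_isAdapted [Finite ι] (H : IsLinked f n I) {U : ∀ u, Submodule k (V u)}
    (hU : IsStable f U) [∀ u, FiniteDimensional k (U u)] (hex : IsExact f I U) :
    ∃ (t : ι → ℕ) (e : ∀ s : (Σ u, Fin (t u)), V s.1), IsAdapted f U e := by
  classical
  have := Fintype.ofFinite ι
  let rad : ∀ v, Submodule k (V v) := fun v => ⨆ w : I v, (U w).map (f w v)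
  have hrad : ∀ v, rad v ≤ U v := fun v => iSup_le fun w => by
    rintro _ ⟨y, hy, rfl⟩
    exact hU _ _ _ hy
  have hW : ∀ v, ∃ W : Submodule k (V v), W ≤ U v ∧ W ⊓ rad v = ⊥ ∧ rad v ⊔ W = U v := by
    intro v
    obtain ⟨C, hC⟩ := Submodule.exists_isCompl (rad v)
    refine ⟨C ⊓ U v, inf_le_right, ?_, ?_⟩
    · rw [inf_right_comm, inf_comm C, hC.inf_eq_bot, bot_inf_eq]
    · rw [← sup_inf_assoc_of_le _ (hrad v), hC.sup_eq_top, top_inf_eq]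
  choose W hWU hWrad hWsup using hW
  have hfin : ∀ v, FiniteDimensional k (W v) := fun v => Submodule.finiteDimensional_of_le (hWU v)
  let t : ι → ℕ := fun v => Module.finrank k (W v)
  let B : ∀ v, Module.Basis (Fin (t v)) k (W v) := fun v => Module.finBasis k (W v)
  let e : ∀ s : (Σ u, Fin (t u)), V s.1 := fun s => B s.1 s.2
  have heU : ∀ s, e s ∈ U s.1 := fun s => hWU _ (B s.1 s.2).2
  have hspan : ∀ v, Submodule.span k (Set.range fun s => f s.1 v (e s)) = U v := by
    intro v
    refine le_antisymm (Submodule.span_le.2 ?_) ?_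
    · rintro _ ⟨s, rfl⟩
      exact hU _ _ _ (heU s)
    · have key : ∀ u, (U u).map (f u v) ≤
          Submodule.span k (Set.range fun s => f s.1 v (e s)) := by
        refine H.path_induction_rev v fun u ih => ?_
        rw [← hWsup u, Submodule.map_sup, sup_le_iff, Submodule.map_iSup]
        constructor
        · refine iSup_le fun w => ?_
          rintro _ ⟨_, ⟨y, hy, rfl⟩, rfl⟩
          rw [H.map_map_ite]
          split_ifs with h
          · exact ih w (H.ne_of_mem w.2) h ⟨y, hy, rfl⟩
          · exact Submodule.zero_mem _
        · rintro _ ⟨y, hy, rfl⟩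
          have : y ∈ Submodule.span k (Set.range fun a => ((B u a : W u) : V u)) := by
            have h1 := (B u).mem_span ⟨y, hy⟩
            have h2 := Submodule.mem_map_of_mem (f := (W u).subtype) h1
            rw [Submodule.map_span, ← Set.range_comp] at h2
            exact h2
          have h3 := Submodule.mem_map_of_mem (f := f u v) this
          rw [Submodule.map_span, ← Set.range_comp] at h3
          refine Submodule.span_mono ?_ h3
          rintro _ ⟨a, rfl⟩
          exact ⟨⟨u, a⟩, rfl⟩
      intro y hy
      exact key v ⟨y, hy, H.map_self v y⟩
  refine ⟨t, e, fun v => ?_, hspan⟩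
  rw [Fintype.linearIndependent_iff]
  intro c hc s₀
  -- The coefficient of one fixed generator `s₀` is followed back along the path from its vertex to
  -- `v`, for all relations at once.
  revert c
  refine H.path_induction s₀.1 (motive := fun v => ∀ c : (Σ u, Fin (t u)) → k,
    ∑ s, c s • f s.1 v (e s) = 0 → c s₀ = 0) (fun v ih c hc => ?_) v
  -- the part of the relation that comes from the arrow `w ⟶ v`
  let y : ∀ w, V w := fun w =>
    ∑ s, if n s.1 v = n s.1 w + n w v then c s • f s.1 w (e s) else 0
  have hyU : ∀ w, y w ∈ U w := fun w => Submodule.sum_mem _ fun s _ => by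
    split_ifs
    · exact Submodule.smul_mem _ _ (hU _ _ _ (heU s))
    · exact Submodule.zero_mem _
  have hfy : ∀ w, f w v (y w) =
      ∑ s, if n s.1 v = n s.1 w + n w v then c s • f s.1 v (e s) else 0 := by
    intro w
    simp only [y, map_sum]
    refine Finset.sum_congr rfl fun s _ => ?_
    split_ifs with h
    · rw [map_smul, H.map_map h]
    · simp
  -- Every generator not at `v` reaches `v` through exactly one arrow, so the relation splits into a
  -- part in the complement and one part for each arrow.
  have hsplit : ∑ s : (Σ u, Fin (t u)), (if s.1 = v then c s • f s.1 v (e s) else 0) +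
      ∑ w with w ∈ I v, f w v (y w) = 0 := by
    refine Eq.trans ?_ hc
    simp only [hfy]
    rw [Finset.sum_comm, ← Finset.sum_add_distrib]
    refine Finset.sum_congr rfl fun s _ => ?_
    by_cases hs : s.1 = v
    · rw [if_pos hs, Finset.sum_eq_zero, add_zero]
      intro w hw
      rw [if_neg]
      intro h
      have h1 := H.adj (Finset.mem_filter.1 hw).2
      have h2 := H.self v
      rw [hs] at h
      omega
    · obtain ⟨w, hw, hsw⟩ := H.pred hs
      rw [if_neg hs, zero_add, Finset.sum_eq_single w, if_pos hsw]
      · intro w' hw' hne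
        rw [if_neg]
        intro h
        exact hne (H.uniq (Finset.mem_filter.1 hw').2 hw h hsw)
      · intro h
        exact absurd (Finset.mem_filter.2 ⟨Finset.mem_univ _, hw⟩) h
  have hWpart : ∑ s : (Σ u, Fin (t u)), (if s.1 = v then c s • f s.1 v (e s) else 0) =
      ((∑ a, c ⟨v, a⟩ • B v a : W v) : V v) := by
    rw [Fintype.sum_sigma, Finset.sum_eq_single v]
    · simp only [if_true, Submodule.coe_sum, Submodule.coe_smul]
      refine Finset.sum_congr rfl fun a _ => ?_
      rw [H.map_self]
    · intro u _ hu
      simp [hu]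
    · simp
  have hradmem : ∑ w with w ∈ I v, f w v (y w) ∈ rad v := by
    refine Submodule.sum_mem _ fun w hw => ?_
    exact Submodule.mem_iSup_of_mem (p := fun w : I v => (U w).map (f w v))
      ⟨w, (Finset.mem_filter.1 hw).2⟩ ⟨_, hyU w, rfl⟩
  have hW0 : ((∑ a, c ⟨v, a⟩ • B v a : W v) : V v) = 0 := by
    have h1 : ((∑ a, c ⟨v, a⟩ • B v a : W v) : V v) ∈ W v ⊓ rad v := by
      refine ⟨Subtype.coe_prop _, ?_⟩
      rw [← hWpart, eq_neg_of_add_eq_zero_left hsplit]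
      exact (rad v).neg_mem hradmem
    rwa [hWrad, Submodule.mem_bot] at h1
  by_cases hs₀ : s₀.1 = v
  · obtain ⟨u₀, a₀⟩ := s₀
    subst hs₀
    exact Fintype.linearIndependent_iff.1 (B u₀).linearIndependent (fun a => c ⟨u₀, a⟩)
      (Subtype.ext hW0) a₀
  · obtain ⟨w, hw, hsw⟩ := H.pred hs₀
    rw [hWpart, hW0, zero_add] at hsplit
    have h0 := H.eq_zero_of_sum_eq_zero v y hsplit hw
    obtain ⟨z, hz, hzy⟩ := hex v w hw (y w) (hyU w) h0
    rw [← hspan v, Submodule.mem_span_range_iff_exists_fun] at hz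
    obtain ⟨b, hb⟩ := hz
    have hadj := H.adj hw
    -- Exactness writes `y w` as `f v w z`, which is a relation at `w`. Generators that reach `w`
    -- through `v` do not reach `v` through `w`, so the coefficient of `s₀` is unchanged.
    have := ih w (H.ne_of_mem hw) hsw (fun s => (if n s.1 v = n s.1 w + n w v then c s else 0) -
      if n s.1 w = n s.1 v + n v w then b s else 0) ?_
    · rw [if_pos hsw, if_neg (by omega), sub_zero] at this
      exact this
    · simp only [sub_smul, Finset.sum_sub_distrib, ite_smul, zero_smul]
      change y w - _ = 0
      rw [← hzy, ← hb, map_sum, sub_eq_zero]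
      refine Finset.sum_congr rfl fun s _ => ?_
      rw [map_smul, H.map_map_ite]
      split_ifs <;> simp

end IsLinked

end LinkedSystems

/-! ### Ranks -/

section Ranks

variable {k : Type*} [Field k] {ι : Type*} {V : ι → Type*} [∀ u, AddCommGroup (V u)]
  [∀ u, Module k (V u)] {f : ∀ u v, V u →ₗ[k] V v} {n : ι → ι → ℤ} {I : ι → Set ι}

/-- The rank of the restriction of `f u v` to a family of subspaces. -/
noncomputable def rank (f : ∀ u v, V u →ₗ[k] V v) (U : ∀ u, Submodule k (V u)) (u v : ι) : ℕ :=
  Module.finrank k ((U u).map (f u v))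

theorem finrank_map_add_finrank_inf_ker {E F : Type*} [AddCommGroup E] [Module k E]
    [AddCommGroup F] [Module k F] (U : Submodule k E) [FiniteDimensional k U] (g : E →ₗ[k] F) :
    Module.finrank k (U.map g) + Module.finrank k (U ⊓ LinearMap.ker g : Submodule k E) =
      Module.finrank k U := by
  have h := LinearMap.finrank_range_add_finrank_ker (g.domRestrict U)
  rw [LinearMap.range_domRestrict, LinearMap.ker_domRestrict] at h
  rw [← h, ← Submodule.map_comap_subtype, LinearEquiv.finrank_eq
    (Submodule.equivMapOfInjective U.subtype U.injective_subtype _).symm]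

namespace IsLinked

theorem map_le_inf_ker (H : IsLinked f n I) {U : ∀ u, Submodule k (V u)} (hU : IsStable f U)
    {v w : ι} (h : n v w + n w v = 1) :
    (U v).map (f v w) ≤ U w ⊓ LinearMap.ker (f w v) := by
  rintro _ ⟨y, hy, rfl⟩
  refine ⟨hU _ _ _ hy, H.map_map_eq_zero ?_ y⟩
  rw [H.self]
  omega

theorem rank_add_rank_of_isExact (H : IsLinked f n I) {U : ∀ u, Submodule k (V u)}
    (hU : IsStable f U) [∀ u, FiniteDimensional k (U u)] (hex : IsExact f I U) {v w : ι}
    (hw : w ∈ I v) : rank f U w v + rank f U v w = Module.finrank k (U w) := by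
  rw [← finrank_map_add_finrank_inf_ker (U w) (f w v), rank, rank]
  have := H.adj hw
  suffices h : (U v).map (f v w) = U w ⊓ LinearMap.ker (f w v) by rw [h]
  refine le_antisymm (H.map_le_inf_ker hU (by omega)) ?_
  rintro y ⟨hy, hy0⟩
  exact hex v w hw y hy hy0

/-- The image of `U v` always lies in the kernel on `U w`; the bound on the ranks says that its
dimension is large enough for equality. -/
theorem exists_of_finrank_le (H : IsLinked f n I) {U : ∀ u, Submodule k (V u)}
    (hU : IsStable f U) [∀ u, FiniteDimensional k (U u)] {v w : ι}
    (hvw : n v w + n w v = 1)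
    (h : Module.finrank k (U w) ≤ rank f U w v + rank f U v w) {y : V w} (hy : y ∈ U w)
    (hy0 : f w v y = 0) : ∃ z ∈ U v, f v w z = y := by
  rw [← finrank_map_add_finrank_inf_ker (U w) (f w v), rank, rank, add_le_add_iff_left] at h
  have := Submodule.eq_of_le_of_finrank_le (H.map_le_inf_ker hU hvw) h
  have hy' : y ∈ U w ⊓ LinearMap.ker (f w v) := ⟨hy, hy0⟩
  rwa [← this] at hy'

end IsLinked

namespace IsAdapted

variable {U : ∀ u, Submodule k (V u)} {t : ι → ℕ} {e : ∀ s : (Σ u, Fin (t u)), V s.1}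

/-- In the adapted bases, `f w v` keeps or kills each basis vector at `w`. By the dichotomy, the
ones it kills reached `w` through `v`, so they are images of basis vectors at `v`. -/
theorem isExact [Finite ι] (he : IsAdapted f U e) (H : IsLinked f n I) : IsExact f I U := by
  classical
  have := Fintype.ofFinite ι
  intro v w hw y hy hy0
  rw [← he.span w, Submodule.mem_span_range_iff_exists_fun] at hy
  obtain ⟨c, rfl⟩ := hy
  have hadj := H.adj hw
  refine ⟨∑ s, c s • f s.1 v (e s), ?_, ?_⟩
  · rw [← he.span v]
    exact Submodule.sum_mem _ fun s _ => Submodule.smul_mem _ _ (Submodule.subset_span ⟨s, rfl⟩)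
  · have h0 : ∑ s, (if n s.1 v = n s.1 w + n w v then c s else 0) • f s.1 v (e s) = 0 := by
      rw [← hy0, map_sum]
      refine Finset.sum_congr rfl fun s _ => ?_
      rw [map_smul, H.map_map_ite]
      split_ifs <;> simp
    have h1 := Fintype.linearIndependent_iff.1 (he.indep v) _ h0
    rw [map_sum]
    refine Finset.sum_congr rfl fun s _ => ?_
    rw [map_smul, H.map_map_ite]
    rcases H.dichotomy_in hadj s.1 with h2 | h2
    · have h3 := h1 s
      rw [if_pos h2] at h3
      simp [h3]
    · rw [if_pos h2]

theorem finrank_eq [Fintype ι] (he : IsAdapted f U e) (v : ι) :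
    Module.finrank k (U v) = ∑ u, t u := by
  rw [← he.span v, finrank_span_eq_card (he.indep v)]
  simp

-- A generator at `w` survives `f u v` exactly if `u` lies between `w` and `v`.
open Classical in
theorem rank_eq [Fintype ι] (he : IsAdapted f U e) (H : IsLinked f n I) (u v : ι) :
    rank f U u v = ∑ w, if n w v = n w u + n u v then t w else 0 := by
  have h1 : (U u).map (f u v) = Submodule.span k (Set.range
      fun s : {s : (Σ u, Fin (t u)) // n s.1 v = n s.1 u + n u v} => f s.1.1 v (e s.1)) := by
    rw [← he.span u, Submodule.map_span, ← Set.range_comp]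
    refine le_antisymm (Submodule.span_le.2 ?_) (Submodule.span_mono ?_)
    · rintro _ ⟨s, rfl⟩
      simp only [Function.comp_apply]
      rw [H.map_map_ite]
      split_ifs with h
      · exact Submodule.subset_span ⟨⟨s, h⟩, rfl⟩
      · exact Submodule.zero_mem _
    · rintro _ ⟨s, rfl⟩
      exact ⟨s, H.map_map s.2 _⟩
  have h2 := (he.indep v).comp (Subtype.val : {s : (Σ u, Fin (t u)) //
    n s.1 v = n s.1 u + n u v} → _) Subtype.val_injective
  rw [rank, h1]
  refine (finrank_span_eq_card h2).trans ?_
  rw [Fintype.card_subtype, Finset.card_filter, Fintype.sum_sigma]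
  refine Finset.sum_congr rfl fun w _ => ?_
  split_ifs <;> simp

/-- The number of generators at a vertex in terms of ranks. -/
theorem add_sum_rank [Fintype ι] (he : IsAdapted f U e) (H : IsLinked f n I) (v : ι)
    [DecidablePred (· ∈ I v)] :
    t v + ∑ w with w ∈ I v, rank f U w v = Module.finrank k (U v) := by
  classical
  simp only [he.rank_eq H, he.finrank_eq]
  rw [Finset.sum_comm, ← Finset.add_sum_erase _ t (Finset.mem_univ v)]
  congr 1
  rw [← Finset.add_sum_erase _ _ (Finset.mem_univ v), Finset.sum_eq_zero, zero_add]
  · refine Finset.sum_congr rfl fun u hu => ?_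
    obtain ⟨w, hw, huw⟩ := H.pred (Finset.ne_of_mem_erase hu)
    rw [Finset.sum_eq_single w, if_pos huw]
    · intro w' hw' hne
      rw [if_neg]
      intro h
      exact hne (H.uniq (Finset.mem_filter.1 hw').2 hw h huw)
    · intro h
      exact absurd (Finset.mem_filter.2 ⟨Finset.mem_univ _, hw⟩) h
  · intro w hw
    rw [if_neg]
    intro h
    have h1 := H.adj (Finset.mem_filter.1 hw).2
    have h2 := H.self v
    omega

/-- A family whose ranks are at least those of an adapted family has generators of the same
type. -/
theorem of_rank_le [Finite ι] (he : IsAdapted f U e) (H : IsLinked f n I)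
    (hU : IsStable f U) {U' : ∀ u, Submodule k (V u)} (hU' : IsStable f U')
    [∀ u, FiniteDimensional k (U u)] [∀ u, FiniteDimensional k (U' u)] {r : ℕ}
    (hr : ∀ u, Module.finrank k (U u) = r) (hr' : ∀ u, Module.finrank k (U' u) = r)
    (hle : ∀ u v, rank f U u v ≤ rank f U' u v) :
    ∃ e' : ∀ s : (Σ u, Fin (t u)), V s.1, IsAdapted f U' e' := by
  classical
  have := Fintype.ofFinite ι
  -- For each arrow the two ranks of an exact family already add up to `r`, so larger ranks force
  -- exactness and then equality of the ranks along arrows.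
  have hex' : IsExact f I U' := by
    intro v w hw y hy hy0
    have h1 := H.adj hw
    refine H.exists_of_finrank_le hU' (by omega) ?_ hy hy0
    rw [hr', ← hr w, ← H.rank_add_rank_of_isExact hU (he.isExact H) hw]
    exact add_le_add (hle _ _) (hle _ _)
  obtain ⟨t', e', he'⟩ := H.exists_isAdapted hU' hex'
  have ht : t' = t := by
    funext v
    have h1 := he.add_sum_rank H v
    have h2 := he'.add_sum_rank H v
    have h3 : ∑ w with w ∈ I v, rank f U' w v = ∑ w with w ∈ I v, rank f U w v := by
      refine Finset.sum_congr rfl fun w hw => ?_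
      have hw' := (Finset.mem_filter.1 hw).2
      have h4 := H.rank_add_rank_of_isExact hU (he.isExact H) hw'
      have h5 := H.rank_add_rank_of_isExact hU' hex' hw'
      have h6 := hle w v
      have h7 := hle v w
      rw [hr] at h4
      rw [hr'] at h5
      omega
    rw [hr] at h1
    rw [hr'] at h2
    omega
  subst ht
  exact ⟨e', he'⟩

end IsAdapted

end Ranks

/-! ### Deformation of stable families which are not exact -/

section Deformation

variable {k : Type*} [Field k] {ι : Type*} {V : ι → Type*} [∀ u, AddCommGroup (V u)]
  [∀ u, Module k (V u)] {f : ∀ u v, V u →ₗ[k] V v} {n : ι → ι → ℤ} {I : ι → Set ι}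

namespace IsLinked

/-- A stable family which is not exact contains, somewhere along a cycle, an element whose image
dies at the last arrow of the cycle and does not come from the preceding vertex. -/
theorem exists_isCycle [Finite ι] (H : IsLinked f n I) {U : ∀ u, Submodule k (V u)}
    (hne : ¬ IsExact f I U) :
    ∃ v h i j, IsArrowSystem.IsCycle n I v h i j ∧ ∃ x ∈ U i, f j v (f i j x) = 0 ∧
      ∀ z ∈ U h, f h j z ≠ f i j x := by
  simp only [IsExact, not_forall, not_exists, not_and] at hne
  obtain ⟨v, j, hj, y, hy, hy0, hyv⟩ := hne
  -- Walk back from `j` towards `v` for as long as `y` lifts. It does not lift to `U v`, so the walk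
  -- stops at some arrow `h ⟶ i`.
  have key : ∀ p, n v j = n v p + n p j → (∃ x ∈ U p, f p j x = y) →
      ∃ h i, IsArrowSystem.IsCycle n I v h i j ∧ ∃ x ∈ U i, f i j x = y ∧
        ∀ z ∈ U h, f h j z ≠ y := by
    refine H.path_induction v fun p ih hp hx => ?_
    obtain ⟨x, hx, hxy⟩ := hx
    have hpv : v ≠ p := by
      rintro rfl
      exact hyv x hx hxy
    obtain ⟨h, hh, hvh⟩ := H.pred hpv
    have t1 := H.tri h p j
    have t2 := H.tri v h j
    by_cases hz : ∃ z ∈ U h, f h j z = y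
    · exact ih h (H.ne_of_mem hh) hvh (by omega) hz
    · push Not at hz
      refine ⟨h, p, ⟨hh, hj, ?_⟩, x, hx, hxy, hz⟩
      have := H.adj hj
      omega
  obtain ⟨h, i, hC, x, hx, rfl, hz⟩ := key j (by rw [H.self, add_zero]) ⟨y, hy, H.map_self _ _⟩
  exact ⟨v, h, i, j, hC, x, hx, hy0, hz⟩

/-- A direction in which to deform the element found in `exists_isCycle`. -/
theorem exists_direction (H : IsLinked f n I) {U : ∀ u, Submodule k (V u)}
    (hU : IsStable f U) [∀ u, FiniteDimensional k (U u)] {r : ℕ}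
    (hr : ∀ u, Module.finrank k (U u) = r) {v i : ι} (hvi : n v i + n i v = 1) {x : V i}
    (hx : x ∈ U i) (hx0 : f i v x = 0) (hxv : ∀ z ∈ U v, f v i z ≠ x) :
    ∃ ξ : V i, f i v ξ ∈ U v ∧ ∀ z ∈ U i, f i v z ≠ f i v ξ := by
  by_contra! hcon
  -- Without such a `ξ`, the kernel of `f v i` on `U v` would lie in `f i v (U i)`. As `U i` and `U
  -- v` have equal dimension, `x` would then come from `U v`.
  have hle : Module.finrank k (U i) ≤ rank f U i v + rank f U v i := by
    rw [hr, ← hr v, ← finrank_map_add_finrank_inf_ker (U v) (f v i), add_comm]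
    refine add_le_add (Submodule.finrank_mono ?_) le_rfl
    rintro y ⟨hy, hy0⟩
    obtain ⟨ξ, rfl⟩ := H.exact hvi y hy0
    obtain ⟨z, hz, hzξ⟩ := hcon ξ hy
    exact ⟨z, hz, hzξ⟩
  obtain ⟨z, hz, hzx⟩ := H.exists_of_finrank_le hU hvi hle hx hx0
  exact hxv z hz hzx

open IsArrowSystem in
/-- Linear forms, compatible with the maps of the system after the vertex `i` of a cycle. -/
theorem exists_forms [Finite ι] (H : IsLinked f n I) [∀ u, FiniteDimensional k (V u)]
    {v h i j : ι} (C : IsCycle n I v h i j) (μ : V j →ₗ[k] k) :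
    ∃ l : ∀ u, V u →ₗ[k] k, (∀ y, l h y = μ (f h j y)) ∧
      (∀ u', n v u' = n v i + n i u' → ∀ y, l u' (f h u' y) = l h y) ∧
      (∀ u u', n v u = n v i + n i u → n v u' = n v i + n i u' →
        n i u' = n i u + n u u' → ∀ y, l u' (f u u' y) = l u y) ∧
      (∀ u u', n v u = n v i + n i u → n v u' = n v i + n i u' →
        n i u' ≠ n i u + n u u' → ∀ y, l u' (f u u' y) = 0) ∧
      (∀ u u', n v u ≠ n v i + n i u → n v u' = n v i + n i u' →
        n u u' ≠ n u h + n h u' → ∀ y, l u' (f u u' y) = 0) := by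
  classical
  have := Fintype.ofFinite ι
  obtain ⟨t, e, he⟩ := H.exists_isAdapted (U := fun u => (⊤ : Submodule k (V u)))
    (fun _ _ _ _ => trivial) H.isExact_top
  let β : ∀ u, Module.Basis (Σ u, Fin (t u)) k (V u) := fun u =>
    Module.Basis.mk (he.indep u) (he.span u).ge
  have hβ : ∀ u s, β u s = f s.1 u (e s) := fun u s => Module.Basis.mk_apply _ _ _
  -- The form keeps only the generators of the ambient system whose path to `j` runs through `h ⟶
  -- i`, with the values of `μ` at `j`. By `IsCycle.between`, these reach every vertex beyond `i`
  -- through `i`, which yields the compatibilities.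
  let c : (Σ u, Fin (t u)) → k := fun s =>
    if n s.1 j = n s.1 h + n h i + n i j then μ (β j s) else 0
  let l : ∀ u, V u →ₗ[k] k := fun u => (β u).constr k c
  have hl : ∀ u s, l u (β u s) = c s := fun u s => (β u).constr_basis k c s
  have hfβ : ∀ u u' s, f u u' (β u s) = if n s.1 u' = n s.1 u + n u u' then β u' s else 0 := by
    intro u u' s
    rw [hβ, H.map_map_ite, hβ]
  have hc0 : ∀ s, n s.1 j ≠ n s.1 h + n h i + n i j → c s = 0 := fun s hs => if_neg hs
  have ext : ∀ {u} {g g' : V u →ₗ[k] k}, (∀ s, g (β u s) = g' (β u s)) → ∀ y, g y = g' y := by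
    intro u g g' hg y
    rw [(β u).ext hg]
  have hlf : ∀ u u' s, l u' (f u u' (β u s)) =
      if n s.1 u' = n s.1 u + n u u' then c s else 0 := by
    intro u u' s
    rw [hfβ]
    split_ifs <;> simp [hl]
  have cyc := C.sum_eq
  have ajv := H.adj C.mem'
  have hself := H.self
  have t1 := H.tri h i j
  have t2 := H.tri v h j
  have t3 := H.tri v h i
  have t4 := H.tri v i j
  have hZ : ∀ s : (Σ u, Fin (t u)), n s.1 j = n s.1 h + n h i + n i j →
      n s.1 i = n s.1 h + n h i := by
    intro s hs
    have := H.tri s.1 h i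
    have := H.tri s.1 i j
    omega
  have hD : ∀ u', n v u' = n v i + n i u' → n h u' = n h i + n i u' := by
    intro u' hu'
    have := H.tri v h u'
    have := H.tri h i u'
    omega
  refine ⟨l, ?_, ?_, ?_, ?_, ?_⟩
  · refine ext (g' := μ ∘ₗ f h j) fun s => ?_
    rw [LinearMap.comp_apply, hl, hfβ]
    have hhj : n h j = n h i + n i j := by omega
    rw [hhj, ← add_assoc]
    simp only [c]
    split_ifs <;> simp
  · intro u' hu'
    refine ext (g := l u' ∘ₗ f h u') fun s => ?_
    rw [LinearMap.comp_apply, hlf, hl]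
    by_cases hs : n s.1 j = n s.1 h + n h i + n i j
    · rw [if_pos]
      have := C.between H.toIsArrowSystem hs hu'
      have := hZ s hs
      have := hD u' hu'
      omega
    · simp [hc0 s hs]
  · intro u u' hu hu' huu'
    refine ext (g := l u' ∘ₗ f u u') fun s => ?_
    rw [LinearMap.comp_apply, hlf, hl]
    by_cases hs : n s.1 j = n s.1 h + n h i + n i j
    · rw [if_pos]
      have := C.between H.toIsArrowSystem hs hu'
      have := C.between H.toIsArrowSystem hs hu
      omega
    · simp [hc0 s hs]
  · intro u u' hu hu' huu'
    refine ext (g := l u' ∘ₗ f u u') (g' := 0) fun s => ?_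
    rw [LinearMap.comp_apply, hlf, LinearMap.zero_apply]
    by_cases hs : n s.1 j = n s.1 h + n h i + n i j
    · rw [if_neg]
      have := C.between H.toIsArrowSystem hs hu'
      have := C.between H.toIsArrowSystem hs hu
      omega
    · simp [hc0 s hs]
  · intro u u' hu hu' huu'
    refine ext (g := l u' ∘ₗ f u u') (g' := 0) fun s => ?_
    rw [LinearMap.comp_apply, hlf, LinearMap.zero_apply]
    by_cases hs : n s.1 j = n s.1 h + n h i + n i j
    · rw [if_neg]
      intro hsu
      have h1 := C.between H.toIsArrowSystem hs hu'
      have h2 := hZ s hs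
      have h3 := hD u' hu'
      have h4 := H.tri v i u
      have h5 := H.tri v u u'
      rcases H.chain hsu h1 with h6 | h6
      · have h7 := H.tri s.1 u i
        have h8 := H.tri s.1 i u'
        have h9 : n s.1 i = n s.1 u + n u i := by omega
        rcases H.chain h9 h2 with h10 | h10
        · omega
        · rcases H.eq_or_eq_of_between C.mem h10 with rfl | rfl
          · omega
          · have := hself u
            omega
      · omega
    · simp [hc0 s hs]

open IsArrowSystem in
/-- A stable family of subspaces of constant dimension which is not exact lies in a
one-parameter family in which some rank is generically larger. -/
theorem exists_deformation [Finite ι] (H : IsLinked f n I) [∀ u, FiniteDimensional k (V u)]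
    {U : ∀ u, Submodule k (V u)} (hU : IsStable f U) {r : ℕ}
    (hr : ∀ u, Module.finrank k (U u) = r) (hne : ¬ IsExact f I U) :
    ∃ (φ : ∀ u, V u →ₗ[k] V u) (c : k) (a b : ι),
      (∀ t : k, 1 + t * c ≠ 0 → ∀ u, Function.Injective (LinearMap.id + t • φ u : V u →ₗ[k] V u)) ∧
      (∀ t : k, IsStable f fun u => (U u).map (LinearMap.id + t • φ u : V u →ₗ[k] V u)) ∧
      ∀ t : k, t ≠ 0 → rank f U a b <
        rank f (fun u => (U u).map (LinearMap.id + t • φ u : V u →ₗ[k] V u)) a b := by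
  classical
  obtain ⟨v, h, i, j, C, x, hx, hx0, hxh⟩ := H.exists_isCycle hne
  have cyc := C.sum_eq
  have ajv := H.adj C.mem'
  have hself := H.self
  have t1 := H.tri h i j
  have t2 := H.tri v h j
  have t3 := H.tri v h i
  have t4 := H.tri v i j
  have t5 := H.tri i j v
  have t6 := H.tri i v i
  have hiv : i ≠ v := by
    rintro rfl
    have := H.pos (H.ne_of_mem C.mem)
    have := hself i
    omega
  have t7 := H.pos hiv
  obtain ⟨ξ, hξ, hξU⟩ := H.exists_direction hU hr (v := v) (i := i) (by omega) hx
    (by rw [← H.map_map (v := j) (by omega), hx0]) (fun z hz hzx => by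
      refine hxh (f v h z) (hU _ _ _ hz) ?_
      rw [← hzx, H.map_map (by omega), H.map_map (by omega)])
  obtain ⟨μ, hμx, hμ⟩ : ∃ μ : V j →ₗ[k] k, μ (f i j x) = 1 ∧ ∀ z ∈ U h, μ (f h j z) = 0 := by
    obtain ⟨μ, hμx, hμ⟩ := Submodule.exists_le_ker_of_notMem (p := (U h).map (f h j))
      (v := f i j x) (by rintro ⟨z, hz, hzx⟩; exact hxh z hz hzx)
    refine ⟨(μ (f i j x))⁻¹ • μ, by simp [hμx], fun z hz => ?_⟩
    have : μ (f h j z) = 0 := hμ ⟨z, hz, rfl⟩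
    simp [this]
  obtain ⟨l, hlh, hlhu, hl1, hl0, hl2⟩ := H.exists_forms C μ
  have hDi : n v i = n v i + n i i := by rw [hself, add_zero]
  have hDj : n v j = n v i + n i j := by omega
  -- Since `f j v` kills `f i j x`, this element comes from `v` in the ambient system, hence through
  -- `h`, where the forms agree with `μ`.
  have hlx : l i x = 1 := by
    rw [← hl1 i j hDi hDj (by rw [hself, zero_add])]
    obtain ⟨b, hb⟩ := H.exact ajv _ hx0
    have hb' : f h j (f v h b) = f i j x := by rw [← hb, H.map_map (by omega)]
    rw [← hb', hlhu j hDj, hlh, hb', hμx]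
  have hlU : ∀ u u', n v u ≠ n v i + n i u → n v u' = n v i + n i u' → ∀ y ∈ U u,
      l u' (f u u' y) = 0 := by
    intro u u' hu hu' y hy
    by_cases huu' : n u u' = n u h + n h u'
    · rw [← H.map_map huu', hlhu u' hu', hlh]
      exact hμ _ (hU _ _ _ hy)
    · exact hl2 u u' hu hu' huu' y
  -- Only the vertices that `v` reaches through `i` are moved, in the direction of the image of `ξ`.
  let φ : ∀ u, V u →ₗ[k] V u := fun u =>
    if n v u = n v i + n i u then (l u).smulRight (f i u ξ) else 0
  have hφ1 : ∀ u, n v u = n v i + n i u → ∀ y, φ u y = l u y • f i u ξ := by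
    intro u hu y
    simp only [φ, if_pos hu, LinearMap.smulRight_apply]
  have hφ0 : ∀ u, n v u ≠ n v i + n i u → ∀ y, φ u y = 0 := by
    intro u hu y
    simp only [φ, if_neg hu, LinearMap.zero_apply]
  refine ⟨φ, l i ξ, i, v, fun t ht u => ?_, fun t u u' => ?_, fun t ht => ?_⟩
  · rw [injective_iff_map_eq_zero]
    intro y hy
    simp only [LinearMap.add_apply, LinearMap.id_apply, LinearMap.smul_apply] at hy
    by_cases hu : n v u = n v i + n i u
    · rw [hφ1 u hu] at hy
      have h1 := congrArg (l u) hy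
      rw [map_add, map_smul, map_smul, hl1 i u hDi hu (by rw [hself, zero_add]), map_zero,
        smul_eq_mul, smul_eq_mul] at h1
      have h2 : l u y * (1 + t * l i ξ) = 0 := by linear_combination h1
      have h3 : l u y = 0 := (mul_eq_zero.1 h2).resolve_right ht
      simpa [h3] using hy
    · simpa [hφ0 u hu] using hy
  · rintro _ ⟨y, hy, rfl⟩
    simp only [LinearMap.add_apply, LinearMap.id_apply, LinearMap.smul_apply, map_add, map_smul]
    have hfy := hU u u' y hy
    by_cases hu : n v u = n v i + n i u <;> by_cases hu' : n v u' = n v i + n i u'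
    -- Both vertices move: the deformation commutes with the map.
    · refine ⟨f u u' y, hfy, ?_⟩
      simp only [LinearMap.add_apply, LinearMap.id_apply, LinearMap.smul_apply]
      rw [hφ1 u hu, hφ1 u' hu', map_smul, H.map_map_ite]
      split_ifs with huu'
      · rw [hl1 u u' hu hu' huu']
      · rw [hl0 u u' hu hu' huu', zero_smul, smul_zero, smul_zero, smul_zero]
    -- Only the source moves. The image of `ξ` at `u'` is zero or arrives through `v`, where `f i v
    -- ξ` already lies in `U v`.
    · refine ⟨f u u' y + t • f u u' (φ u y), (U u').add_mem hfy ((U u').smul_mem _ ?_), ?_⟩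
      · rw [hφ1 u hu, map_smul, H.map_map_ite]
        refine (U u').smul_mem _ ?_
        split_ifs with huu'
        · have h1 : n i u' = n i v + n v u' := by
            rcases H.dichotomy_out (a := i) (b := v) (by omega) u' with h1 | h1
            · exact h1
            · exact absurd h1 hu'
          rw [← H.map_map h1]
          exact hU _ _ _ hξ
        · exact Submodule.zero_mem _
      · simp only [LinearMap.add_apply, LinearMap.id_apply, LinearMap.smul_apply]
        rw [hφ0 u' hu', smul_zero, add_zero]
    -- Only the target moves: its form vanishes on what comes from `U u`.
    · refine ⟨f u u' y, hfy, ?_⟩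
      simp only [LinearMap.add_apply, LinearMap.id_apply, LinearMap.smul_apply]
      rw [hφ0 u hu, hφ1 u' hu', hlU u u' hu hu' y hy]
      simp
    · refine ⟨f u u' y, hfy, ?_⟩
      simp only [LinearMap.add_apply, LinearMap.id_apply, LinearMap.smul_apply]
      rw [hφ0 u hu, hφ0 u' hu']
      simp
  · rw [rank, rank, ← Submodule.map_comp]
    have h1 := finrank_map_add_finrank_inf_ker (U i) (f i v)
    have h2 := finrank_map_add_finrank_inf_ker (U i) (f i v ∘ₗ (LinearMap.id + t • φ i))
    have happ : ∀ y, (f i v ∘ₗ (LinearMap.id + t • φ i)) y = f i v y + (t * l i y) • f i v ξ := by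
      intro y
      simp only [LinearMap.comp_apply, LinearMap.add_apply, LinearMap.id_apply,
        LinearMap.smul_apply, map_add, map_smul]
      rw [hφ1 i hDi, map_smul, smul_smul, H.map_self]
    -- By the choice of `ξ`, an element killed after the deformation has `l i y = 0` and was killed
    -- before. The element `x` was killed before, but is no longer, since `l i x = 1`.
    have hlt : (U i ⊓ LinearMap.ker (f i v ∘ₗ (LinearMap.id + t • φ i)) : Submodule k (V i)) <
        U i ⊓ LinearMap.ker (f i v) := by
      have hx00 : f i v x = 0 := by rw [← H.map_map (v := j) (by omega), hx0]
      refine lt_of_le_of_ne ?_ fun heq => ?_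
      · rintro y ⟨hy, hy0⟩
        refine ⟨hy, ?_⟩
        rw [SetLike.mem_coe, LinearMap.mem_ker, happ] at hy0
        have hly : t * l i y = 0 := by
          by_contra hly
          refine hξU (-(t * l i y)⁻¹ • y) ((U i).smul_mem _ hy) ?_
          rw [map_smul, eq_neg_of_add_eq_zero_left hy0, smul_neg, neg_smul, neg_neg, smul_smul,
            inv_mul_cancel₀ hly, one_smul]
        rw [hly, zero_smul, add_zero] at hy0
        exact hy0
      · have h3 : x ∈ U i ⊓ LinearMap.ker (f i v) := ⟨hx, hx00⟩
        rw [← heq] at h3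
        have h4 := h3.2
        rw [SetLike.mem_coe, LinearMap.mem_ker, happ, hx00, hlx, zero_add, mul_one] at h4
        refine hξU 0 (U i).zero_mem ?_
        rw [map_zero, (smul_eq_zero.1 h4).resolve_left ht]
    have := Submodule.finrank_lt_finrank_of_lt hlt
    omega

end IsLinked

end Deformation

/-! ### The linked system of a locally weakly independent configuration -/

section Lattices

set_option linter.unusedSectionVars false

variable {R : Type u} [CommRing R] [IsDomain R] [IsDiscreteValuationRing R]
  {K : Type w} [Field K] [Algebra R K] [IsFractionRing R K] {ϖ : R} {d : ℕ} {ι : Type x}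

theorem piPow_add (hϖ : Irreducible ϖ) (m n : ℤ) :
    piPow K ϖ (m + n) = piPow K ϖ m * piPow K ϖ n := by
  have h0 : algebraMap R K ϖ ≠ 0 := by simpa using hϖ.ne_zero
  exact zpow_add₀ h0 m n

theorem piPow_ne_zero (hϖ : Irreducible ϖ) (n : ℤ) : piPow K ϖ n ≠ 0 := by
  have h0 : algebraMap R K ϖ ≠ 0 := by simpa using hϖ.ne_zero
  exact zpow_ne_zero n h0

@[simp]
theorem piPow_zero : piPow K ϖ 0 = 1 := zpow_zero _

theorem piPow_natCast_smul (n : ℕ) (y : Fin d → K) : piPow K ϖ n • y = ϖ ^ n • y := by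
  rw [← algebraMap_smul K (ϖ ^ n) y, map_pow, piPow, zpow_natCast]

theorem piPow_one_smul (y : Fin d → K) : piPow K ϖ 1 • y = ϖ • y := by
  simpa using piPow_natCast_smul (ϖ := ϖ) 1 y

theorem smul_le_iff {c : K} {L L' : Submodule R (Fin d → K)} :
    c • L ≤ L' ↔ ∀ y ∈ L, c • y ∈ L' := by
  constructor
  · intro h y hy
    exact h (Submodule.smul_mem_pointwise_smul y _ _ hy)
  · rintro h _ ⟨y, hy, rfl⟩
    exact h y hy

variable (Γ : Configuration R K d ι)

theorem piPow_smul_mem_iff (hϖ : Irreducible ϖ) (hd : 0 < d) (i j : ι) (n : ℤ) :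
    (∀ y ∈ Γ.L i, piPow K ϖ n • y ∈ Γ.L j) ↔ exponent ϖ Γ i j ≤ n := by
  have h := exponent_isLeast hϖ hd Γ i j
  rw [← smul_le_iff]
  refine ⟨fun hn => h.2 hn, fun hn => ?_⟩
  obtain ⟨m, rfl⟩ := Int.le.dest hn
  rw [smul_le_iff]
  intro y hy
  rw [add_comm, piPow_add hϖ, mul_smul, piPow_natCast_smul]
  exact (Γ.L j).smul_mem _ (smul_le_iff.1 h.1 y hy)

theorem exponent_self (hϖ : Irreducible ϖ) (hd : 0 < d) (i : ι) : exponent ϖ Γ i i = 0 := by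
  refine le_antisymm ((piPow_smul_mem_iff Γ hϖ hd i i 0).1 fun y hy => by simpa using hy) ?_
  by_contra! hlt
  have h := (piPow_smul_mem_iff Γ hϖ hd i i (-1)).2 (by omega)
  -- A negative exponent would give `L = ϖ L`, which Nakayama's lemma excludes for a nonzero
  -- lattice.
  have key : ∀ y ∈ Γ.L i, y ∈ Ideal.span {ϖ} • Γ.L i := by
    intro y hy
    have : y = ϖ • (piPow K ϖ (-1) • y) := by
      rw [← piPow_one_smul, smul_smul, ← piPow_add hϖ]
      simp
    rw [this]
    exact Submodule.smul_mem_smul (Ideal.mem_span_singleton_self ϖ) (h y hy)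
  have hbot : Γ.L i = ⊥ := by
    refine Submodule.eq_bot_of_le_smul_of_le_jacobson_bot (Ideal.span {ϖ}) _
      (Γ.isLattice i).fg key ?_
    rw [IsLocalRing.jacobson_eq_maximalIdeal ⊥ bot_ne_top, hϖ.maximalIdeal_eq]
  have htop := (Γ.isLattice i).span_eq_top
  rw [hbot] at htop
  have : Nonempty (Fin d) := ⟨⟨0, hd⟩⟩
  simp at htop

theorem exponent_triangle (hϖ : Irreducible ϖ) (hd : 0 < d) (i j l : ι) :
    exponent ϖ Γ i l ≤ exponent ϖ Γ i j + exponent ϖ Γ j l := by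
  rw [← piPow_smul_mem_iff Γ hϖ hd]
  intro y hy
  rw [add_comm, piPow_add hϖ, mul_smul]
  exact (piPow_smul_mem_iff Γ hϖ hd j l _).2 le_rfl _
    ((piPow_smul_mem_iff Γ hϖ hd i j _).2 le_rfl _ hy)

theorem exponent_add_pos (hϖ : Irreducible ϖ) (hd : 0 < d) {i j : ι} (hij : i ≠ j) :
    0 < exponent ϖ Γ i j + exponent ϖ Γ j i := by
  by_contra! hle
  refine hij (Γ.eq_of_homothetic i j
    ⟨piPow K ϖ (exponent ϖ Γ i j), piPow_ne_zero hϖ _, le_antisymm ?_ ?_⟩)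
  · intro y hy
    have h1 : piPow K ϖ (-exponent ϖ Γ i j) • y ∈ Γ.L i :=
      (piPow_smul_mem_iff Γ hϖ hd j i _).2 (by omega) y hy
    have h2 : y = piPow K ϖ (exponent ϖ Γ i j) • piPow K ϖ (-exponent ϖ Γ i j) • y := by
      rw [smul_smul, ← piPow_add hϖ]
      simp
    rw [h2]
    exact Submodule.smul_mem_pointwise_smul _ _ _ h1
  · exact smul_le_iff.2 ((piPow_smul_mem_iff Γ hϖ hd i j _).2 le_rfl)

theorem mk_eq_zero_iff (hϖ : Irreducible ϖ) (L : Submodule R (Fin d → K)) (y : L) :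
    (1 : Kappa R) ⊗ₜ[R] y = 0 ↔ ∃ z ∈ L, (y : Fin d → K) = ϖ • z := by
  have h := LinearMap.ker_tensorProductMk (R := R) (Q := L) (I := IsLocalRing.maximalIdeal R)
  have h1 : (1 : Kappa R) ⊗ₜ[R] y = 0 ↔
      y ∈ (IsLocalRing.maximalIdeal R) • (⊤ : Submodule R L) := by
    rw [← h, LinearMap.mem_ker]
    rfl
  rw [h1, hϖ.maximalIdeal_eq, Submodule.ideal_span_singleton_smul]
  constructor
  · rintro ⟨z, -, rfl⟩
    exact ⟨z, z.2, rfl⟩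
  · rintro ⟨z, hz, h⟩
    exact ⟨⟨z, hz⟩, trivial, Subtype.ext h.symm⟩

theorem exists_mk_eq (L : Submodule R (Fin d → K)) (y : Kappa R ⊗[R] L) :
    ∃ z : L, (1 : Kappa R) ⊗ₜ[R] z = y :=
  TensorProduct.mk_surjective R L (Kappa R) IsLocalRing.residue_surjective y

theorem smallF_mk (hϖ : Irreducible ϖ) (hd : 0 < d) (i j : ι) (y : Γ.L i) :
    smallF ϖ Γ i j (1 ⊗ₜ y) = 1 ⊗ₜ ⟨piPow K ϖ (exponent ϖ Γ i j) • (y : Fin d → K),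
      (piPow_smul_mem_iff Γ hϖ hd i j _).2 le_rfl y y.2⟩ := by
  have h : piPow K ϖ (exponent ϖ Γ i j) • Γ.L i ≤ Γ.L j := (exponent_isLeast hϖ hd Γ i j).1
  rw [smallF, LinearMap.baseChange_tmul, bigF, dif_pos h]
  rfl

theorem smallF_mk_eq_zero_iff (hϖ : Irreducible ϖ) (hd : 0 < d) (i j : ι) (y : Γ.L i) :
    smallF ϖ Γ i j (1 ⊗ₜ y) = 0 ↔
      piPow K ϖ (exponent ϖ Γ i j - 1) • (y : Fin d → K) ∈ Γ.L j := by
  rw [smallF_mk Γ hϖ hd, mk_eq_zero_iff hϖ]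
  have h1 : piPow K ϖ (exponent ϖ Γ i j) • (y : Fin d → K) =
      ϖ • piPow K ϖ (exponent ϖ Γ i j - 1) • (y : Fin d → K) := by
    rw [← piPow_one_smul (ϖ := ϖ), smul_smul, ← piPow_add hϖ]
    congr 2
    omega
  constructor
  · rintro ⟨z, hz, h⟩
    have h2 : ϖ • piPow K ϖ (exponent ϖ Γ i j - 1) • (y : Fin d → K) = ϖ • z := by rw [← h1, ← h]
    rw [← piPow_one_smul (ϖ := ϖ), ← piPow_one_smul (ϖ := ϖ)] at h2
    rw [smul_right_injective _ (piPow_ne_zero hϖ 1) h2]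
    exact hz
  · intro h
    exact ⟨_, h, h1⟩

theorem smallF_self (hϖ : Irreducible ϖ) (hd : 0 < d) (i : ι) (y : Γ.Lbar i) :
    smallF ϖ Γ i i y = y := by
  obtain ⟨z, rfl⟩ := exists_mk_eq (Γ.L i) y
  rw [smallF_mk Γ hϖ hd]
  congr 1
  ext1
  simp [exponent_self Γ hϖ hd]

theorem smallF_smallF (hϖ : Irreducible ϖ) (hd : 0 < d) {i j l : ι}
    (h : exponent ϖ Γ i l = exponent ϖ Γ i j + exponent ϖ Γ j l) (y : Γ.Lbar i) :
    smallF ϖ Γ j l (smallF ϖ Γ i j y) = smallF ϖ Γ i l y := by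
  obtain ⟨z, rfl⟩ := exists_mk_eq (Γ.L i) y
  rw [smallF_mk Γ hϖ hd, smallF_mk Γ hϖ hd, smallF_mk Γ hϖ hd]
  congr 1
  ext1
  simp only [smul_smul, ← piPow_add hϖ, h, add_comm]

/-- The composite multiplies by a power of `ϖ` larger than necessary, so it is divisible by `ϖ`. -/
theorem smallF_smallF_eq_zero (hϖ : Irreducible ϖ) (hd : 0 < d) {i j l : ι}
    (h : exponent ϖ Γ i l ≠ exponent ϖ Γ i j + exponent ϖ Γ j l) (y : Γ.Lbar i) :
    smallF ϖ Γ j l (smallF ϖ Γ i j y) = 0 := by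
  obtain ⟨z, rfl⟩ := exists_mk_eq (Γ.L i) y
  rw [smallF_mk Γ hϖ hd, smallF_mk_eq_zero_iff Γ hϖ hd, smul_smul, ← piPow_add hϖ]
  refine (piPow_smul_mem_iff Γ hϖ hd i l _).2 ?_ z z.2
  have := exponent_triangle Γ hϖ hd i j l
  omega

theorem smallF_ne_zero (hϖ : Irreducible ϖ) (hd : 0 < d) (i j : ι) : smallF ϖ Γ i j ≠ 0 := by
  intro h
  have h1 := (piPow_smul_mem_iff Γ hϖ hd i j (exponent ϖ Γ i j - 1)).1 fun y hy => by
    rw [← smallF_mk_eq_zero_iff Γ hϖ hd i j ⟨y, hy⟩, h, LinearMap.zero_apply]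
  omega

theorem exponent_eq_of_smallF_eq (hϖ : Irreducible ϖ) (hd : 0 < d) {i j l : ι}
    (h : smallF ϖ Γ i l = smallF ϖ Γ j l ∘ₗ smallF ϖ Γ i j) :
    exponent ϖ Γ i l = exponent ϖ Γ i j + exponent ϖ Γ j l := by
  by_contra hne
  refine smallF_ne_zero Γ hϖ hd i l ?_
  rw [h]
  refine LinearMap.ext fun y => ?_
  exact smallF_smallF_eq_zero Γ hϖ hd hne y

/-- A vector killed by the map can be divided once more by `ϖ` in the target. As `exponent ϖ Γ i j -
1 = -exponent ϖ Γ j i`, the map back returns it to `y`. -/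
theorem exists_smallF_eq (hϖ : Irreducible ϖ) (hd : 0 < d) {i j : ι}
    (h : exponent ϖ Γ i j + exponent ϖ Γ j i = 1) (y : Γ.Lbar i) (hy : smallF ϖ Γ i j y = 0) :
    ∃ z, smallF ϖ Γ j i z = y := by
  obtain ⟨y, rfl⟩ := exists_mk_eq (Γ.L i) y
  rw [smallF_mk_eq_zero_iff Γ hϖ hd] at hy
  refine ⟨1 ⊗ₜ ⟨_, hy⟩, ?_⟩
  rw [smallF_mk Γ hϖ hd]
  congr 1
  ext1
  simp only [smul_smul, ← piPow_add hϖ]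
  have : exponent ϖ Γ j i + (exponent ϖ Γ i j - 1) = 0 := by omega
  rw [this, piPow_zero, one_smul]

instance finite_Lbar (i : ι) : Module.Finite (Kappa R) (Γ.Lbar i) := by
  have : Module.Finite R (Γ.L i) := Module.Finite.iff_fg.2 (Γ.isLattice i).fg
  infer_instance

theorem nontrivial_Lbar (hϖ : Irreducible ϖ) (hd : 0 < d) (i : ι) : Nontrivial (Γ.Lbar i) := by
  by_contra h
  rw [not_nontrivial_iff_subsingleton] at h
  exact smallF_ne_zero Γ hϖ hd i i (LinearMap.ext fun y => Subsingleton.elim _ _)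

/-- Multiplication by a nonzero scalar of `K` changes a lattice like a power of the uniformizer. -/
theorem exists_piPow_smul_eq (hϖ : Irreducible ϖ) {a : K} (ha : a ≠ 0)
    (L : Submodule R (Fin d → K)) : ∃ s : ℤ, a • L = piPow K ϖ s • L := by
  obtain ⟨s, c, hc⟩ := IsDiscreteValuationRing.exists_units_eq_smul_zpow_of_irreducible hϖ ha
  have hc' : a = piPow K ϖ s * algebraMap R K c := by
    rw [hc, Units.smul_def, Algebra.smul_def, mul_comm]
    rfl
  refine ⟨s, le_antisymm (smul_le_iff.2 fun y hy => ?_) (smul_le_iff.2 fun y hy => ?_)⟩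
  · rw [hc', mul_smul, algebraMap_smul]
    exact Submodule.smul_mem_pointwise_smul _ _ _ (L.smul_mem _ hy)
  · have h1 : piPow K ϖ s • y = a • ((c⁻¹ : Rˣ) : R) • y := by
      rw [hc', mul_smul, algebraMap_smul, smul_smul (c : R)]
      simp
    rw [h1]
    exact Submodule.smul_mem_pointwise_smul _ _ _ (L.smul_mem _ hy)

/-- A vertex whose lattice is, up to homothety, the intersection of the lattice of `v` and a
multiple of the lattice of `w`. -/
theorem Configuration.IsConvex.exists_inf (hΓ : Γ.IsConvex) (hϖ : Irreducible ϖ) (v w : ι)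
    (m : ℤ) : ∃ (i : ι) (s : ℤ), ∀ y : Fin d → K,
      (piPow K ϖ (-s) • y ∈ Γ.L i ↔ y ∈ Γ.L v ∧ piPow K ϖ (-m) • y ∈ Γ.L w) := by
  obtain ⟨i, a, ha, h⟩ := hΓ v w 1 (piPow K ϖ m) one_ne_zero (piPow_ne_zero hϖ m)
  obtain ⟨s, hs⟩ := exists_piPow_smul_eq hϖ ha (Γ.L i)
  have hmem : ∀ (s : ℤ) (L : Submodule R (Fin d → K)) (y : Fin d → K),
      y ∈ piPow K ϖ s • L ↔ piPow K ϖ (-s) • y ∈ L := by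
    intro s L y
    constructor
    · rintro ⟨z, hz, rfl⟩
      change piPow K ϖ (-s) • piPow K ϖ s • z ∈ L
      rw [smul_smul, ← piPow_add hϖ]
      simpa using hz
    · intro hy
      have := Submodule.smul_mem_pointwise_smul _ (piPow K ϖ s) L hy
      rw [smul_smul, ← piPow_add hϖ] at this
      simpa using this
  refine ⟨i, s, fun y => ?_⟩
  rw [← hmem, ← hs, ← h, Submodule.mem_inf, one_smul, hmem]

/-- The sources of the arrows with target `v` are adjacent to `v`. -/
theorem exponent_add_eq_one (hϖ : Irreducible ϖ) (hd : 0 < d) (hΓ : Γ.IsConvex) {I : Set ι} {v w : ι}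
    (hpred : ∀ u, u ≠ v → ∃ w ∈ I, smallF ϖ Γ u v = smallF ϖ Γ w v ∘ₗ smallF ϖ Γ u w)
    (huniq : ∀ {u w w'}, w ∈ I → w' ∈ I →
      exponent ϖ Γ u v = exponent ϖ Γ u w + exponent ϖ Γ w v →
      exponent ϖ Γ u v = exponent ϖ Γ u w' + exponent ϖ Γ w' v → w = w')
    (hw : w ∈ I) (hwv : w ≠ v) : exponent ϖ Γ w v + exponent ϖ Γ v w = 1 := by
  have hpos := exponent_add_pos Γ hϖ hd hwv
  by_contra hne
  -- The class of `L v ⊓ ϖ ^ (exponent ϖ Γ w v - 1) L w` lies between `w` and `v`. It differs from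
  -- `v` unless `v` and `w` are adjacent.
  obtain ⟨i, s, hi⟩ := hΓ.exists_inf Γ hϖ v w (exponent ϖ Γ w v - 1)
  have tri := exponent_triangle Γ hϖ hd
  have hself := exponent_self Γ hϖ hd
  have h1 : exponent ϖ Γ i v ≤ s := by
    rw [← piPow_smul_mem_iff Γ hϖ hd]
    intro y hy
    refine ((hi _).1 ?_).1
    rw [smul_smul, ← piPow_add hϖ]
    simpa using hy
  have h2 : exponent ϖ Γ w i ≤ exponent ϖ Γ w v - s := by
    rw [← piPow_smul_mem_iff Γ hϖ hd]
    intro y hy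
    have h3 := (hi (piPow K ϖ (exponent ϖ Γ w v) • y)).2
      ⟨(piPow_smul_mem_iff Γ hϖ hd w v _).2 le_rfl y hy, ?_⟩
    · rw [smul_smul, ← piPow_add hϖ] at h3
      rwa [sub_eq_neg_add]
    · rw [smul_smul, ← piPow_add hϖ]
      exact (piPow_smul_mem_iff Γ hϖ hd w w _).2 (by rw [hself]; omega) y hy
  have h3 := tri w i v
  have hiv : i ≠ v := by
    rintro rfl
    have h4 : exponent ϖ Γ i w ≤ 1 - exponent ϖ Γ w i := by
      rw [← piPow_smul_mem_iff Γ hϖ hd]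
      intro y hy
      have h5 := ((hi y).1 ((piPow_smul_mem_iff Γ hϖ hd i i _).2 ?_ y hy)).2
      · rwa [neg_sub] at h5
      · have := hself i
        omega
    omega
  obtain ⟨w', hw', hw'v⟩ := hpred i hiv
  have h4 := exponent_eq_of_smallF_eq Γ hϖ hd hw'v
  -- The last arrow from `i` to `v` is also the last one on a path from `w`.
  obtain rfl : w' = w := by
    refine huniq (u := w) hw' hw ?_ ?_
    · have := tri w i w'
      have := tri w w' v
      omega
    · have := hself w
      omega
  -- Thus `w` lies between `i` and `v`, so the intersection is contained in `ϖ ^ exponent ϖ Γ w' v`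
  -- times `L w'`. Repeating this, with multiplication by powers of `ϖ`, puts all of `L v` there,
  -- which contradicts positivity.
  have h5 : ∀ y ∈ Γ.L v, piPow K ϖ (-(exponent ϖ Γ w' v - 1)) • y ∈ Γ.L w' →
      piPow K ϖ (-exponent ϖ Γ w' v) • y ∈ Γ.L w' := by
    intro y hy hy'
    have h6 := (piPow_smul_mem_iff Γ hϖ hd i w' _).2 le_rfl _ ((hi y).2 ⟨hy, hy'⟩)
    rw [smul_smul, ← piPow_add hϖ] at h6
    have h7 : exponent ϖ Γ i w' + -s = -exponent ϖ Γ w' v := by omega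
    rwa [h7] at h6
  have h6 : ∀ (e : ℕ), ∀ y ∈ Γ.L v, piPow K ϖ (e + -exponent ϖ Γ w' v) • y ∈ Γ.L w' →
      piPow K ϖ (-exponent ϖ Γ w' v) • y ∈ Γ.L w' := by
    intro e
    induction e with
    | zero => intro y _ hy; simpa using hy
    | succ e ih =>
      intro y hy hy'
      refine ih y hy ?_
      have h7 := h5 (piPow K ϖ e • y) (by rw [piPow_natCast_smul]; exact (Γ.L v).smul_mem _ hy) ?_
      · rwa [smul_smul, ← piPow_add hϖ, add_comm] at h7
      · rw [smul_smul, ← piPow_add hϖ]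
        convert hy' using 2
        push_cast
        ring_nf
  have h7 : exponent ϖ Γ v w' ≤ -exponent ϖ Γ w' v := by
    rw [← piPow_smul_mem_iff Γ hϖ hd]
    intro y hy
    refine h6 (exponent ϖ Γ w' v + exponent ϖ Γ v w').toNat y hy ?_
    refine (piPow_smul_mem_iff Γ hϖ hd v w' _).2 ?_ y hy
    omega
  omega

/-- The reductions of the lattices of a locally weakly independent configuration form a linked
system. -/
theorem IsLocallyWeaklyIndependent.exists_isLinked (hΓ : IsLocallyWeaklyIndependent ϖ Γ)
    (hϖ : Irreducible ϖ) (hd : 0 < d) :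
    ∃ I : ι → Set ι, IsLinked (smallF ϖ Γ) (exponent ϖ Γ) I := by
  choose I hpred hker hindep using hΓ.indep
  have huniq : ∀ {u v w w'}, w ∈ I v → w' ∈ I v →
      exponent ϖ Γ u v = exponent ϖ Γ u w + exponent ϖ Γ w v →
      exponent ϖ Γ u v = exponent ϖ Γ u w' + exponent ϖ Γ w' v → w = w' := by
    intro u v w w' hw hw' h h'
    by_contra hne
    have hdisj := (hindep v).pairwiseDisjoint
      (show (⟨w, hw⟩ : I v) ≠ ⟨w', hw'⟩ from fun h => hne (congrArg Subtype.val h))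
    refine smallF_ne_zero Γ hϖ hd u v (LinearMap.ext fun y => ?_)
    refine (Submodule.disjoint_def.1 hdisj) _ ⟨smallF ϖ Γ u w y, ?_⟩ ⟨smallF ϖ Γ u w' y, ?_⟩
    · exact smallF_smallF Γ hϖ hd h y
    · exact smallF_smallF Γ hϖ hd h' y
  refine ⟨I, ⟨exponent_self Γ hϖ hd, exponent_triangle Γ hϖ hd, exponent_add_pos Γ hϖ hd,
    fun {u v} huv => ?_, huniq, fun {v w} hw => ?_⟩, smallF_self Γ hϖ hd, smallF_smallF Γ hϖ hd,
    smallF_smallF_eq_zero Γ hϖ hd, exists_smallF_eq Γ hϖ hd, hindep, smallF_ne_zero Γ hϖ hd⟩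
  · obtain ⟨w, hw, h⟩ := hpred v u huv
    exact ⟨w, hw, exponent_eq_of_smallF_eq Γ hϖ hd h⟩
  · refine exponent_add_eq_one Γ hϖ hd hΓ.convex (hpred v) huniq hw ?_
    -- For `w = v` the map is the identity, whose image is not its kernel.
    rintro rfl
    have h := hker w w hw
    have hid : smallF ϖ Γ w w = LinearMap.id := LinearMap.ext (smallF_self Γ hϖ hd w)
    rw [hid, LinearMap.range_id, LinearMap.ker_id] at h
    have := nontrivial_Lbar Γ hϖ hd w
    exact top_ne_bot h

end Lattices

/-! ### Paths -/

theorem le_addWeightOfEPs {V : Type*} [Quiver V] {n : V → V → ℤ} (self : ∀ u, n u u = 0)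
    (tri : ∀ u v w, n u w ≤ n u v + n v w) {i j : V} (p : Quiver.Path i j) :
    n i j ≤ p.addWeightOfEPs n := by
  induction p with
  | nil => simp [self, Quiver.Path.addWeightOfEPs_nil]
  | @cons b c p e ih =>
    rw [Quiver.Path.addWeightOfEPs_cons]
    have := tri i b c
    omega

section Paths

set_option linter.unusedSectionVars false

variable {R : Type u} [CommRing R] [IsDomain R] [IsDiscreteValuationRing R]
  {K : Type w} [Field K] [Algebra R K] {ϖ : R} {d : ℕ} {ι : Type x}
  {Γ : Configuration R K d ι} {I : ι → Set ι}

/-- The sum of the exponents along a path of `Q'`. -/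
noncomputable def fullWeight {i j : FullVertex Γ} (ϖ : R) (p : Quiver.Path i j) : ℤ :=
  Quiver.Path.addWeightOfEPs (V := FullVertex Γ) (exponent ϖ Γ) p

/-- The sum of the exponents along a path of `Q`. -/
noncomputable def weight {i j : Vertex ϖ Γ} (p : Quiver.Path i j) : ℤ :=
  Quiver.Path.addWeightOfEPs (V := Vertex ϖ Γ) (exponent ϖ Γ) p

theorem fullWeight_nil (i : FullVertex Γ) : fullWeight ϖ (.nil : Quiver.Path i i) = 0 :=
  Quiver.Path.addWeightOfEPs_nil ..

theorem fullWeight_cons {i j l : FullVertex Γ} (p : Quiver.Path i j) (e : j ⟶ l) :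
    fullWeight ϖ (p.cons e) = fullWeight ϖ p + exponent ϖ Γ j l :=
  Quiver.Path.addWeightOfEPs_cons ..

theorem weight_nil (i : Vertex ϖ Γ) : weight (.nil : Quiver.Path i i) = 0 :=
  Quiver.Path.addWeightOfEPs_nil ..

theorem weight_cons {i j l : Vertex ϖ Γ} (p : Quiver.Path i j) (e : j ⟶ l) :
    weight (p.cons e) = weight p + exponent ϖ Γ j l :=
  Quiver.Path.addWeightOfEPs_cons ..

theorem weight_comp {i j l : Vertex ϖ Γ} (p : Quiver.Path i j) (q : Quiver.Path j l) :
    weight (p.comp q) = weight p + weight q :=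
  Quiver.Path.addWeightOfEPs_comp ..

namespace IsLinked

variable (H : IsLinked (smallF ϖ Γ) (exponent ϖ Γ) I)
include H

theorem le_weight {i j : Vertex ϖ Γ} (p : Quiver.Path i j) :
    exponent ϖ Γ i j ≤ weight p :=
  le_addWeightOfEPs (V := Vertex ϖ Γ) (n := exponent ϖ Γ) H.self H.tri p

theorem le_weight' {i j : FullVertex Γ} (p : Quiver.Path i j) :
    exponent ϖ Γ i j ≤ fullWeight ϖ p :=
  le_addWeightOfEPs (V := FullVertex Γ) (n := exponent ϖ Γ) H.self H.tri p

open Classical in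
theorem pathMap_apply {i j : FullVertex Γ} (p : Quiver.Path i j) (y : Γ.Lbar i) :
    pathMap ϖ Γ i j p y =
      if exponent ϖ Γ i j = fullWeight ϖ p then smallF ϖ Γ i j y else 0 := by
  induction p with
  | nil =>
    rw [fullWeight_nil, if_pos (H.self i)]
    exact (H.map_self i y).symm
  | @cons b c p e ih =>
    have h1 := H.le_weight' p
    have h2 := H.tri i b c
    have h3 : pathMap ϖ Γ i c (p.cons e) y = smallF ϖ Γ b c (pathMap ϖ Γ i b p y) := rfl
    rw [h3, ih, fullWeight_cons]
    split_ifs with h4 h5 h5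
    · exact H.map_map (by rw [h4, h5]) y
    · exact H.map_map_eq_zero (by rwa [h4]) y
    · omega
    · exact map_zero _

theorem exists_between_of_two_le_length {i j : FullVertex Γ} (p : Quiver.Path i j)
    (hlen : 2 ≤ p.length) (hp : exponent ϖ Γ i j = fullWeight ϖ p) :
    ∃ b, b ≠ i ∧ b ≠ j ∧ exponent ϖ Γ i j = exponent ϖ Γ i b + exponent ϖ Γ b j := by
  cases p with
  | nil => simp at hlen
  | @cons b _ p e =>
    rw [fullWeight_cons] at hp
    have h1 := H.le_weight' p
    have h2 := H.tri i b j
    refine ⟨b, ?_, e.down, by omega⟩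
    -- A return to the starting vertex would have positive weight, so the path would not be minimal.
    rintro rfl
    cases p with
    | nil => simp at hlen
    | @cons c _ p e' =>
      rw [fullWeight_cons] at hp h1
      have h3 := H.le_weight' p
      have h5 := H.pos e'.down
      have h6 := H.self b
      omega

/-- A factorization of `f w v` along a longer path would produce a vertex strictly between `w` and
`v`. -/
theorem nonempty_hom {v w : ι} (hw : w ∈ I v) :
    Nonempty (@Quiver.Hom (Vertex ϖ Γ) _ w v) := by
  refine ⟨⟨H.ne_of_mem hw, ?_⟩⟩
  rintro ⟨p, hlen, hp⟩
  obtain ⟨b, hbw, hbv, hb⟩ := H.exists_between_of_two_le_length p hlen (by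
    by_contra hne
    refine H.ne_zero w v (LinearMap.ext fun y => ?_)
    rw [← hp]
    exact (H.pathMap_apply p y).trans (if_neg hne))
  rcases H.eq_or_eq_of_between hw hb with h | h
  · exact hbw h
  · exact hbv h

/-- Every map of the linked system comes from a path of the quiver. -/
theorem exists_path [Finite ι] (u v : ι) :
    ∃ p : Quiver.Path (V := Vertex ϖ Γ) u v,
      weight p = exponent ϖ Γ u v := by
  refine H.path_induction u (motive := fun v => ∃ p : Quiver.Path (V := Vertex ϖ Γ) u v,
    weight p = exponent ϖ Γ u v) (fun v ih => ?_) v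
  rcases eq_or_ne u v with rfl | huv
  · exact ⟨.nil, (weight_nil (u : Vertex ϖ Γ)).trans (H.self u).symm⟩
  · obtain ⟨w, hw, huw⟩ := H.pred huv
    obtain ⟨p, hp⟩ := ih w (H.ne_of_mem hw) huw
    obtain ⟨a⟩ := H.nonempty_hom hw
    exact ⟨p.cons a, (weight_cons p a).trans (by rw [hp]; exact huw.symm)⟩

open Classical in
theorem ambientRep_map_apply {i j : Vertex ϖ Γ} (p : Quiver.Path i j) (y : Γ.Lbar i) :
    ((ambientRep ϖ Γ).map p).hom y =
      if exponent ϖ Γ i j = weight p then smallF ϖ Γ i j y else 0 := by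
  induction p with
  | nil =>
    rw [weight_nil, if_pos (H.self i)]
    exact (H.map_self i y).symm
  | @cons b c p e ih =>
    have h1 := H.le_weight p
    have h2 := H.tri i b c
    have h3 : ((ambientRep ϖ Γ).map (p.cons e)).hom y =
      smallF ϖ Γ b c (((ambientRep ϖ Γ).map p).hom y) := rfl
    rw [h3, ih, weight_cons]
    split_ifs with h4 h5 h5
    · exact H.map_map (by rw [h4, h5]) y
    · exact H.map_map_eq_zero (by rwa [h4]) y
    · omega
    · exact map_zero _

end IsLinked

namespace satisfiesRelations

variable {N : QuiverRep ϖ Γ} (hN : satisfiesRelations ϖ Γ N)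
include hN

theorem map_eq_zero {i j : Paths (Vertex ϖ Γ)} {p : i ⟶ j} (hp : (ambientRep ϖ Γ).map p = 0) :
    N.map p = 0 := by
  have := hN i j (Finsupp.single p 1) (by simp [hp])
  simpa using this

theorem map_eq_map {i j : Paths (Vertex ϖ Γ)} {p q : i ⟶ j}
    (hpq : (ambientRep ϖ Γ).map p = (ambientRep ϖ Γ).map q) : N.map p = N.map q := by
  have key : ∀ N : QuiverRep ϖ Γ, ((Finsupp.single p (1 : Kappa R) - Finsupp.single q 1).sum
      fun p a => a • N.map p) = N.map p - N.map q := by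
    intro N
    rw [Finsupp.sum_sub_index (fun _ _ _ => sub_smul _ _ _)]
    simp
  have := hN i j (Finsupp.single p 1 - Finsupp.single q 1) (by rw [key, hpq, sub_self])
  rwa [key, sub_eq_zero] at this

end satisfiesRelations

namespace IsLinked

variable (H : IsLinked (smallF ϖ Γ) (exponent ϖ Γ) I)
include H

/-- In a representation with relations, a path acts as any other path with the same ends, if it
does not act as zero. -/
theorem map_map_of_satisfiesRelations {N : QuiverRep ϖ Γ} (hN : satisfiesRelations ϖ Γ N)
    {i j l : Vertex ϖ Γ} {p : Quiver.Path i j} {q : Quiver.Path j l} {s : Quiver.Path i l}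
    (hp : weight p = exponent ϖ Γ i j)
    (hq : weight q = exponent ϖ Γ j l)
    (hs : weight s = exponent ϖ Γ i l)
    (h : exponent ϖ Γ i l = exponent ϖ Γ i j + exponent ϖ Γ j l)
    (y : N.obj i) : (N.map q).hom ((N.map p).hom y) = (N.map s).hom y := by
  have h1 : N.map (p.comp q) = N.map s := by
    refine hN.map_eq_map (ModuleCat.hom_ext (LinearMap.ext fun y => ?_))
    refine (H.ambientRep_map_apply _ y).trans ((H.ambientRep_map_apply _ y).trans ?_).symm
    rw [weight_comp, hp, hq, hs, ← h]
  have h2 : N.map (p.comp q) = N.map p ≫ N.map q := N.map_comp p q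
  rw [← h1, h2]
  rfl

theorem map_map_of_satisfiesRelations_eq_zero {N : QuiverRep ϖ Γ}
    (hN : satisfiesRelations ϖ Γ N)
    {i j l : Vertex ϖ Γ} {p : Quiver.Path i j} {q : Quiver.Path j l}
    (hp : weight p = exponent ϖ Γ i j)
    (hq : weight q = exponent ϖ Γ j l)
    (h : exponent ϖ Γ i l ≠ exponent ϖ Γ i j + exponent ϖ Γ j l)
    (y : N.obj i) : (N.map q).hom ((N.map p).hom y) = 0 := by
  have h1 : N.map (p.comp q) = 0 := by
    refine hN.map_eq_zero (ModuleCat.hom_ext (LinearMap.ext fun y => ?_))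
    refine (H.ambientRep_map_apply _ y).trans ?_
    rw [weight_comp, hp, hq, if_neg h]
    rfl
  have h2 : N.map (p.comp q) = N.map p ≫ N.map q := N.map_comp p q
  have h3 : (N.map q).hom ((N.map p).hom y) = (N.map (p.comp q)).hom y := by
    rw [h2]
    rfl
  rw [h3, h1]
  rfl

end IsLinked

end Paths

/-! ### Bases given by systems of generators. -/

section AdaptedBasis

variable {k : Type*} [Field k] {ι : Type*} {V : ι → Type*} [∀ u, AddCommGroup (V u)]
  [∀ u, Module k (V u)] {f : ∀ u v, V u →ₗ[k] V v}
  {U : ∀ u, Submodule k (V u)} {t : ι → ℕ} {e : ∀ s : (Σ u, Fin (t u)), V s.1}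

/-- The basis at the vertex `v` given by a system of generators. -/
noncomputable def IsAdapted.basis (he : IsAdapted f U e) (v : ι) :
    Module.Basis (Σ u, Fin (t u)) k (U v) :=
  (Module.Basis.span (he.indep v)).map (LinearEquiv.ofEq _ _ (he.span v))

theorem IsAdapted.coe_basis (he : IsAdapted f U e) (v : ι) (s : Σ u, Fin (t u)) :
    (he.basis v s : V v) = f s.1 v (e s) := by
  simp [IsAdapted.basis, Module.Basis.span_apply]

theorem IsAdapted.of_basis (b : ∀ v, Module.Basis (Σ u, Fin (t u)) k (U v))
    (hb : ∀ v s, (b v s : V v) = f s.1 v (e s)) : IsAdapted f U e := by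
  constructor
  · intro v
    have := (b v).linearIndependent.map' (U v).subtype (Submodule.ker_subtype _)
    have h1 : (fun s => f s.1 v (e s)) = (U v).subtype ∘ b v := by
      funext s
      exact (hb v s).symm
    rw [h1]
    exact this
  · intro v
    have h1 : (fun s => f s.1 v (e s)) = (U v).subtype ∘ b v := by
      funext s
      exact (hb v s).symm
    rw [h1, Set.range_comp, ← Submodule.map_span, (b v).span_eq, Submodule.map_top,
      Submodule.range_subtype]

end AdaptedBasis

/-! ### Points with adapted generators, as projective representations. -/

section Points

set_option linter.unusedSectionVars false

variable {R : Type u} [CommRing R] [IsDomain R] [IsDiscreteValuationRing R]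
  {K : Type w} [Field K] [Algebra R K] {ϖ : R} {d : ℕ} {ι : Type x}
  {Γ : Configuration R K d ι} {I : ι → Set ι} {r : ℕ}

theorem weight_toPath {i j : Vertex ϖ Γ} (q : i ⟶ j) : weight q.toPath = exponent ϖ Γ i j :=
  (weight_cons .nil q).trans
    ((congrArg (· + exponent ϖ Γ i j) (weight_nil (ϖ := ϖ) (Γ := Γ) i)).trans (zero_add _))

namespace SpecialFiber

theorem isStable (M : SpecialFiber ϖ Γ r) : IsStable (smallF ϖ Γ) M.E := M.smallF_mem

theorem rep_map_coe (M : SpecialFiber ϖ Γ r) {i j : Paths (Vertex ϖ Γ)} (p : i ⟶ j)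
    (y : M.rep.obj i) : (M.E j).subtype ((M.rep.map p).hom y) =
      ((ambientRep ϖ Γ).map p).hom ((M.E i).subtype y) :=
  congrArg (fun g => g.hom y) (M.incl.naturality p)

end SpecialFiber

namespace IsLinked

variable (H : IsLinked (smallF ϖ Γ) (exponent ϖ Γ) I)
include H

open Classical in
theorem rep_map_apply (M : SpecialFiber ϖ Γ r) {i j : Vertex ϖ Γ} (p : Quiver.Path i j)
    (y : M.E i) : (M.E j).subtype ((M.rep.map p).hom y) =
      if exponent ϖ Γ i j = weight p then smallF ϖ Γ i j y else 0 :=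
  (M.rep_map_coe p y).trans (H.ambientRep_map_apply p _)

end IsLinked

/-- Epimorphisms of representations with relations are surjective at each vertex. -/
theorem BoundRep.epi_hom {N N' : BoundRep ϖ Γ} (g : N ⟶ N') [Epi g] : Epi g.hom := by
  -- Relations pass to quotients, so the cokernel can be tested inside the category with relations.
  have hC : satisfiesRelations ϖ Γ (Limits.cokernel g.hom) := by
    intro i j c hc
    have h1 := N'.property i j c hc
    have h2 : Epi ((Limits.cokernel.π g.hom).app i) := inferInstance
    rw [← cancel_epi ((Limits.cokernel.π g.hom).app i), Limits.comp_zero, Finsupp.sum,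
      Preadditive.comp_sum]
    simp only [Linear.comp_smul, ← NatTrans.naturality]
    simp only [← Linear.smul_comp]
    rw [← Preadditive.sum_comp]
    rw [Finsupp.sum] at h1
    rw [h1, Limits.zero_comp]
  let C : BoundRep ϖ Γ := ⟨Limits.cokernel g.hom, hC⟩
  let π : N' ⟶ C := ObjectProperty.homMk (Limits.cokernel.π g.hom)
  have h1 : π = ObjectProperty.homMk 0 := by
    rw [← cancel_epi g]
    ext1
    exact (Limits.cokernel.condition g.hom).trans Limits.comp_zero.symm
  have h2 : Limits.cokernel.π g.hom = 0 := congrArg (fun h => h.hom) h1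
  exact Abelian.epi_of_cokernel_π_eq_zero _ h2

theorem BoundRep.surjective_app {N N' : BoundRep ϖ Γ} (g : N ⟶ N') [Epi g]
    (i : Paths (Vertex ϖ Γ)) : Function.Surjective (g.hom.app i).hom := by
  have := BoundRep.epi_hom g
  have : Epi (g.hom.app i) := inferInstance
  exact (ModuleCat.epi_iff_surjective _).1 this

section Adapted

variable {t : ι → ℕ} {e : ∀ s : (Σ u, Fin (t u)), Γ.Lbar s.1}

/-- The value of the maps of the representation of an adapted point on the basis. -/
theorem IsAdapted.rep_map_basis {M : SpecialFiber ϖ Γ r}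
    (he : IsAdapted (smallF ϖ Γ) M.E e) (H : IsLinked (smallF ϖ Γ) (exponent ϖ Γ) I)
    {i j : ι} (p : Quiver.Path (V := Vertex ϖ Γ) i j) (hp : weight p = exponent ϖ Γ i j)
    (s : Σ u, Fin (t u)) (h : exponent ϖ Γ s.1 j = exponent ϖ Γ s.1 i + exponent ϖ Γ i j) :
    (M.rep.map p).hom (he.basis i s) = he.basis j s :=
  Subtype.ext <| (H.rep_map_apply M p (he.basis i s)).trans <| (if_pos hp.symm).trans <|
    (congrArg (smallF ϖ Γ i j) (he.coe_basis i s)).trans <| (H.map_map h _).trans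
      (he.coe_basis j s).symm

theorem IsAdapted.rep_map_basis_eq_zero {M : SpecialFiber ϖ Γ r}
    (he : IsAdapted (smallF ϖ Γ) M.E e) (H : IsLinked (smallF ϖ Γ) (exponent ϖ Γ) I)
    {i j : ι} (p : Quiver.Path (V := Vertex ϖ Γ) i j) (hp : weight p = exponent ϖ Γ i j)
    (s : Σ u, Fin (t u)) (h : exponent ϖ Γ s.1 j ≠ exponent ϖ Γ s.1 i + exponent ϖ Γ i j) :
    (M.rep.map p).hom (he.basis i s) = 0 :=
  Subtype.ext <| (H.rep_map_apply M p (he.basis i s)).trans <| (if_pos hp.symm).trans <|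
    (congrArg (smallF ϖ Γ i j) (he.coe_basis i s)).trans (H.map_map_eq_zero h _)

theorem IsAdapted.rep_map_basis_self {M : SpecialFiber ϖ Γ r}
    (he : IsAdapted (smallF ϖ Γ) M.E e) (H : IsLinked (smallF ϖ Γ) (exponent ϖ Γ) I)
    (s : Σ u, Fin (t u)) {j : ι} (p : Quiver.Path (V := Vertex ϖ Γ) s.1 j)
    (hp : weight p = exponent ϖ Γ s.1 j) :
    (M.rep.map p).hom (he.basis s.1 s) = he.basis j s :=
  he.rep_map_basis H p hp s (by rw [H.self, zero_add])

/-- The morphism from the representation of an adapted point that is given by the images of the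
generators. -/
theorem IsAdapted.exists_hom {M : SpecialFiber ϖ Γ r}
    (he : IsAdapted (smallF ϖ Γ) M.E e) (H : IsLinked (smallF ϖ Γ) (exponent ϖ Γ) I)
    (p : ∀ u v : ι, Quiver.Path (V := Vertex ϖ Γ) u v)
    (hp : ∀ u v, weight (p u v) = exponent ϖ Γ u v)
    {N : QuiverRep ϖ Γ} (hN : satisfiesRelations ϖ Γ N)
    (y : ∀ s : (Σ u, Fin (t u)), N.obj (s.1 : Vertex ϖ Γ)) :
    ∃ g : M.rep ⟶ N, ∀ (v : ι) s,
      (g.app v).hom (he.basis v s) = (N.map (p s.1 v)).hom (y s) := by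
  let a : ∀ v : ι, M.E v →ₗ[Kappa R] N.obj (v : Vertex ϖ Γ) := fun v =>
    (he.basis v).constr (Kappa R) fun s => (N.map (p s.1 v)).hom (y s)
  have ha : ∀ v s, a v (he.basis v s) = (N.map (p s.1 v)).hom (y s) := fun v s =>
    (he.basis v).constr_basis _ _ _
  refine ⟨Paths.liftNatTrans (fun v => ModuleCat.ofHom (a v)) fun {i j} q => ?_, ha⟩
  refine ModuleCat.hom_ext ((he.basis i).ext fun s => ?_)
  have hq : weight (Quiver.Hom.toPath q) = exponent ϖ Γ i j := weight_toPath q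
  change a j ((M.rep.map q.toPath).hom (he.basis i s)) =
    (N.map q.toPath).hom (a i (he.basis i s))
  by_cases h : exponent ϖ Γ s.1 j = exponent ϖ Γ s.1 i + exponent ϖ Γ i j
  · exact (congrArg (a j) (he.rep_map_basis H q.toPath hq s h)).trans <| (ha j s).trans <|
      (H.map_map_of_satisfiesRelations hN (hp _ _) hq (hp _ _) h _).symm.trans
        (congrArg (N.map q.toPath).hom (ha i s).symm)
  · exact (congrArg (a j) (he.rep_map_basis_eq_zero H q.toPath hq s h)).trans <|
      (map_zero (a j)).trans <|
      (H.map_map_of_satisfiesRelations_eq_zero hN (hp _ _) hq h _).symm.trans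
        (congrArg (N.map q.toPath).hom (ha i s).symm)

/-- A morphism out of the representation is a free choice of images of the generators, and these
lift through surjections. -/
theorem IsAdapted.isProjective [Finite ι] {M : SpecialFiber ϖ Γ r}
    (he : IsAdapted (smallF ϖ Γ) M.E e) (H : IsLinked (smallF ϖ Γ) (exponent ϖ Γ) I) :
    M.IsProjective := by
  choose p hp using H.exists_path
  refine ⟨fun {E X} φ g _ => ?_⟩
  have hsurj := fun s : (Σ u, Fin (t u)) =>
    BoundRep.surjective_app g (s.1 : Vertex ϖ Γ) ((φ.hom.app s.1).hom (he.basis s.1 s))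
  choose y hy using hsurj
  obtain ⟨l, hl⟩ := he.exists_hom H p hp E.property y
  refine ⟨ObjectProperty.homMk l, ObjectProperty.hom_ext _ ?_⟩
  refine NatTrans.ext (funext fun v => ModuleCat.hom_ext ((he.basis v).ext fun s => ?_))
  have h1 : (φ.hom.app v).hom ((M.rep.map (p s.1 v)).hom (he.basis s.1 s)) =
      (X.obj.map (p s.1 v)).hom ((φ.hom.app s.1).hom (he.basis s.1 s)) :=
    congrArg (fun h => h.hom (he.basis s.1 s)) (φ.hom.naturality (p s.1 v))
  have h2 : (g.hom.app v).hom ((E.obj.map (p s.1 v)).hom (y s)) =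
      (X.obj.map (p s.1 v)).hom ((g.hom.app s.1).hom (y s)) :=
    congrArg (fun h => h.hom (y s)) (g.hom.naturality (p s.1 v))
  change (g.hom.app v).hom ((l.app v).hom (he.basis v s)) = (φ.hom.app v).hom (he.basis v s)
  exact (congrArg (g.hom.app v).hom (hl v s)).trans <| h2.trans <|
    (congrArg (X.obj.map (p s.1 v)).hom (hy s)).trans <| h1.symm.trans
      (congrArg (φ.hom.app v).hom (he.rep_map_basis_self H s (p s.1 v) (hp _ _)))

/-- Points with generators of the same type are isomorphic. -/
theorem IsAdapted.nonempty_iso [Finite ι] {M N : SpecialFiber ϖ Γ r}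
    (he : IsAdapted (smallF ϖ Γ) M.E e) {e' : ∀ s : (Σ u, Fin (t u)), Γ.Lbar s.1}
    (he' : IsAdapted (smallF ϖ Γ) N.E e') (H : IsLinked (smallF ϖ Γ) (exponent ϖ Γ) I) :
    Nonempty (M.rep ≅ N.rep) := by
  choose p hp using H.exists_path
  obtain ⟨g, hg⟩ := he.exists_hom H p hp N.satisfiesRelations_rep fun s => he'.basis s.1 s
  obtain ⟨g', hg'⟩ := he'.exists_hom H p hp M.satisfiesRelations_rep fun s => he.basis s.1 s
  have hb : ∀ (v : ι) s, (g.app v).hom (he.basis v s) = he'.basis v s := fun v s =>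
    (hg v s).trans (he'.rep_map_basis_self H s (p s.1 v) (hp _ _))
  have hb' : ∀ (v : ι) s, (g'.app v).hom (he'.basis v s) = he.basis v s := fun v s =>
    (hg' v s).trans (he.rep_map_basis_self H s (p s.1 v) (hp _ _))
  refine ⟨⟨g, g', ?_, ?_⟩⟩
  · refine NatTrans.ext (funext fun v => ModuleCat.hom_ext ((he.basis v).ext fun s => ?_))
    exact (congrArg (g'.app v).hom (hb v s)).trans (hb' v s)
  · refine NatTrans.ext (funext fun v => ModuleCat.hom_ext ((he'.basis v).ext fun s => ?_))
    exact (congrArg (g.app v).hom (hb' v s)).trans (hb v s)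

theorem IsAdapted.of_iso [Finite ι] {M N : SpecialFiber ϖ Γ r}
    (he : IsAdapted (smallF ϖ Γ) M.E e) (H : IsLinked (smallF ϖ Γ) (exponent ϖ Γ) I)
    (α : M.rep ≅ N.rep) :
    ∃ e' : ∀ s : (Σ u, Fin (t u)), Γ.Lbar s.1, IsAdapted (smallF ϖ Γ) N.E e' := by
  choose p hp using H.exists_path
  let b : ∀ v : ι, Module.Basis (Σ u, Fin (t u)) (Kappa R) (N.E v) := fun v =>
    (he.basis v).map (α.app (v : Vertex ϖ Γ)).toLinearEquiv
  refine ⟨fun s => b s.1 s, IsAdapted.of_basis b fun v s => ?_⟩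
  have h1 : (α.hom.app v).hom ((M.rep.map (p s.1 v)).hom (he.basis s.1 s)) =
      (N.rep.map (p s.1 v)).hom ((α.hom.app s.1).hom (he.basis s.1 s)) :=
    congrArg (fun h => h.hom (he.basis s.1 s)) (α.hom.naturality (p s.1 v))
  have h2 := (H.rep_map_apply N (p s.1 v) (b s.1 s)).trans (if_pos (hp _ _).symm)
  exact (congrArg (N.E v).subtype ((congrArg (α.hom.app v).hom
    (he.rep_map_basis_self H s (p s.1 v) (hp _ _)).symm).trans h1)).trans h2

end Adapted

end Points

/-! ### Projective points are exact -/

section Covers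

set_option linter.unusedSectionVars false

variable {R : Type u} [CommRing R] [IsDomain R] [IsDiscreteValuationRing R]
  {K : Type w} [Field K] [Algebra R K] {ϖ : R} {d : ℕ} {ι : Type x}
  {Γ : Configuration R K d ι} {I : ι → Set ι} {r : ℕ}

open Classical in
/-- The maps of the projective representation with generators `X a` at the vertices `c a`. -/
noncomputable def coverMap (ϖ : R) (Γ : Configuration R K d ι) {N : ℕ} (c : Fin N → ι)
    (X : Fin N → Type (max u w)) [∀ a, AddCommGroup (X a)] [∀ a, Module (Kappa R) (X a)]
    (i j : ι) : (∀ a, X a) →ₗ[Kappa R] ∀ a, X a :=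
  LinearMap.pi fun a => if exponent ϖ Γ (c a) j = exponent ϖ Γ (c a) i + exponent ϖ Γ i j then
    LinearMap.proj a else 0

/-- The projective representation with generators `X a` at the vertices `c a`. -/
noncomputable def coverRep (ϖ : R) (Γ : Configuration R K d ι) {N : ℕ} (c : Fin N → ι)
    (X : Fin N → Type (max u w)) [∀ a, AddCommGroup (X a)] [∀ a, Module (Kappa R) (X a)] :
    QuiverRep ϖ Γ :=
  Paths.lift
    { obj := fun _ => ModuleCat.of (Kappa R) (∀ a, X a)
      map := fun {i j} _ => ModuleCat.ofHom (coverMap ϖ Γ c X i j) }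

open Classical in
theorem coverMap_apply {N : ℕ} (c : Fin N → ι)
    (X : Fin N → Type (max u w)) [∀ a, AddCommGroup (X a)] [∀ a, Module (Kappa R) (X a)]
    (i j : ι) (y : ∀ a, X a) (a : Fin N) : coverMap ϖ Γ c X i j y a =
      if exponent ϖ Γ (c a) j = exponent ϖ Γ (c a) i + exponent ϖ Γ i j then y a else 0 := by
  simp only [coverMap, LinearMap.pi_apply]
  split_ifs <;> rfl

namespace IsLinked

variable (H : IsLinked (smallF ϖ Γ) (exponent ϖ Γ) I) {N : ℕ} (c : Fin N → ι)
    (X : Fin N → Type (max u w)) [∀ a, AddCommGroup (X a)] [∀ a, Module (Kappa R) (X a)]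
include H

open Classical in
theorem coverRep_map_apply {i j : Vertex ϖ Γ} (p : Quiver.Path i j) (y : ∀ a, X a) (a : Fin N) :
    (((coverRep ϖ Γ c X).map p).hom y : ∀ a, X a) a =
      if exponent ϖ Γ (c a) j = exponent ϖ Γ (c a) i + weight p then y a else 0 := by
  induction p with
  | nil =>
    rw [weight_nil, if_pos (add_zero _).symm]
    rfl
  | @cons b l p e ih =>
    have h1 := H.le_weight p
    have h2 := H.tri i b l
    have h4 := H.tri (c a) b l
    have h5 := H.tri (c a) i b
    have h3 : (((coverRep ϖ Γ c X).map (p.cons e)).hom y : ∀ a, X a) a =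
        coverMap ϖ Γ c X b l (((coverRep ϖ Γ c X).map p).hom y) a := rfl
    have h7 : weight (p.cons e) = weight p + exponent ϖ Γ b l := weight_cons p e
    refine h3.trans ((coverMap_apply c X b l _ a).trans ?_)
    generalize ((coverRep ϖ Γ c X).map p).hom y = z at ih ⊢
    have ih' : (show ∀ a, X a from z) a =
      if exponent ϖ Γ (c a) b = exponent ϖ Γ (c a) i + weight p then y a else 0 := ih
    split_ifs with h8 h9 h9
    · exact ih'.trans (if_pos (by omega))
    · exact ih'.trans (if_neg (by omega))
    · omega
    · rfl

/-- A combination of parallel paths acts on `M_Γ` as `S` times the nonzero map `f i j`, where `S`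
sums the coefficients of the paths of minimal weight. On each summand of the cover it acts as `S` or
as zero. -/
theorem satisfiesRelations_coverRep : satisfiesRelations ϖ Γ (coverRep ϖ Γ c X) := by
  classical
  intro i j s hs
  have happ : ∀ (N : QuiverRep ϖ Γ) (y : N.obj i),
      (s.sum fun p a => a • N.map p).hom y = ∑ p ∈ s.support, s p • (N.map p).hom y := by
    intro N y
    simp [Finsupp.sum, ModuleCat.hom_sum]
  let S : Kappa R := ∑ p ∈ s.support, if exponent ϖ Γ i j = weight p then s p else 0
  have hS : S = 0 := by
    by_contra hne
    refine H.ne_zero i j (LinearMap.ext fun y => ?_)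
    have h1 := happ (ambientRep ϖ Γ) y
    rw [hs] at h1
    have h2 : S • smallF ϖ Γ i j y = 0 := by
      refine Eq.trans ?_ h1.symm
      rw [Finset.sum_smul]
      refine Finset.sum_congr rfl fun p _ => ?_
      refine Eq.trans ?_ (congrArg (s p • ·) (H.ambientRep_map_apply p y)).symm
      split_ifs
      · rfl
      · exact (zero_smul (Kappa R) (smallF ϖ Γ i j y)).trans
          (smul_zero (A := Γ.Lbar j) (s p)).symm
    exact (inv_smul_smul₀ hne (smallF ϖ Γ i j y)).symm.trans
      ((congrArg (S⁻¹ • ·) h2).trans (smul_zero (A := Γ.Lbar j) S⁻¹))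
  refine ModuleCat.hom_ext (LinearMap.ext fun y => (happ _ y).trans (funext fun a => ?_))
  refine (Finset.sum_apply _ _ _).trans ?_
  have h1 : ∀ p ∈ s.support, (s p • ((coverRep ϖ Γ c X).map p).hom y : ∀ a, X a) a =
      if exponent ϖ Γ (c a) j = exponent ϖ Γ (c a) i + exponent ϖ Γ i j then
        (if exponent ϖ Γ i j = weight p then s p else 0) • y a else 0 := by
    intro p _
    refine (congrArg (s p • ·) (H.coverRep_map_apply c X p y a)).trans ?_
    have h2 := H.le_weight p
    have h3 := H.tri (c a) i j
    split_ifs <;> first | rfl | omega | simp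
  rw [Finset.sum_congr rfl h1]
  split_ifs
  · rw [← Finset.sum_smul]
    change S • y a = 0
    rw [hS, zero_smul]
  · rw [Finset.sum_const_zero]
    rfl

end IsLinked

/-- The map onto the space of a point at a vertex from the sum of the spaces at the vertices
`c a`. -/
noncomputable def SpecialFiber.coverHom (M : SpecialFiber ϖ Γ r) {N : ℕ} (c : Fin N → ι) (i : ι) :
    (∀ a, M.E (c a)) →ₗ[Kappa R] M.E i :=
  ∑ a, (smallF ϖ Γ (c a) i).restrict (M.smallF_mem _ _) ∘ₗ LinearMap.proj a

theorem SpecialFiber.coe_coverHom (M : SpecialFiber ϖ Γ r) {N : ℕ} (c : Fin N → ι) (i : ι)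
    (y : ∀ a, M.E (c a)) :
    (M.coverHom c i y : Γ.Lbar i) = ∑ a, smallF ϖ Γ (c a) i (y a) := by
  simp [SpecialFiber.coverHom]

/-- The sum of the projectives generated by the spaces `M.E u` covers the point, and projectivity
splits the cover. The cover is exact by the dichotomy, and the splitting transfers exactness to the
point. -/
theorem SpecialFiber.IsProjective.isExact [Finite ι] {M : SpecialFiber ϖ Γ r}
    (hM : M.IsProjective) (H : IsLinked (smallF ϖ Γ) (exponent ϖ Γ) I) :
    IsExact (smallF ϖ Γ) I M.E := by
  classical
  let c := (Finite.equivFin ι).symm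
  let P : BoundRep ϖ Γ := ⟨coverRep ϖ Γ c fun a => M.E (c a), H.satisfiesRelations_coverRep c _⟩
  have hnat : ∀ (i j : ι) (y : ∀ a, M.E (c a)),
      (M.coverHom c j (coverMap ϖ Γ c (fun a => M.E (c a)) i j y) : Γ.Lbar j) =
        smallF ϖ Γ i j (M.coverHom c i y) := by
    intro i j y
    rw [M.coe_coverHom, M.coe_coverHom, map_sum]
    refine Finset.sum_congr rfl fun a _ => ?_
    rw [coverMap_apply, H.map_map_ite]
    split_ifs <;> simp
  have hsurj : ∀ i, Function.Surjective (M.coverHom c i) := by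
    intro i y
    obtain ⟨a, rfl⟩ := c.surjective i
    refine ⟨Pi.single a y, Subtype.ext ?_⟩
    rw [M.coe_coverHom, Finset.sum_eq_single a]
    · rw [Pi.single_eq_same, H.map_self]
    · intro b _ hb
      rw [Pi.single_eq_of_ne hb]
      exact map_zero _
    · simp
  let π : P ⟶ M.boundRep := ObjectProperty.homMk <|
    Paths.liftNatTrans (fun i => ModuleCat.ofHom (M.coverHom c i)) fun {i j} q => by
      refine ModuleCat.hom_ext (LinearMap.ext fun y => Subtype.ext ?_)
      have h1 : weight q.toPath = exponent ϖ Γ i j := weight_toPath q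
      refine Eq.trans ?_ ((H.rep_map_apply M q.toPath (M.coverHom c i y)).trans
        (if_pos h1.symm)).symm
      refine Eq.trans ?_ (hnat i j y)
      refine congrArg (fun z => (M.coverHom c j z : Γ.Lbar j)) (funext fun a => ?_)
      refine (H.coverRep_map_apply c (fun a => M.E (c a)) q.toPath y a).trans ?_
      rw [h1]
      exact (coverMap_apply c _ i j y a).symm
  have hepi : Epi π := by
    have h1 : ∀ i, Epi (π.hom.app i) := fun i =>
      (ModuleCat.epi_iff_surjective _).2 (hsurj i)
    have h2 : Epi π.hom := NatTrans.epi_of_epi_app _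
    exact (satisfiesRelations ϖ Γ).ι.epi_of_epi_map h2
  have : Projective M.boundRep := hM
  let σ : M.boundRep ⟶ P := Projective.factorThru (𝟙 _) π
  have hσ : σ ≫ π = 𝟙 _ := Projective.factorThru_comp _ _
  intro v w hw y hy hy0
  have hadj := H.adj hw
  obtain ⟨q⟩ := H.nonempty_hom hw
  have hq : weight q.toPath = exponent ϖ Γ w v := weight_toPath q
  let Y : ∀ a, M.E (c a) := (σ.hom.app (w : Vertex ϖ Γ)).hom (⟨y, hy⟩ : M.E w)
  have hY : M.coverHom c w Y = ⟨y, hy⟩ :=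
    congrArg (fun g => (g.hom.app (w : Vertex ϖ Γ)).hom (⟨y, hy⟩ : M.E w)) hσ
  have h0 : (M.rep.map q.toPath).hom (⟨y, hy⟩ : M.E w) = 0 :=
    Subtype.ext ((H.rep_map_apply M q.toPath ⟨y, hy⟩).trans ((if_pos hq.symm).trans hy0))
  have h1 : (P.obj.map q.toPath).hom Y = 0 :=
    (congrArg (fun g => g.hom (⟨y, hy⟩ : M.E w)) (σ.hom.naturality q.toPath)).symm.trans
      ((congrArg (σ.hom.app (v : Vertex ϖ Γ)).hom h0).trans (map_zero _))
  -- The components that survive `w ⟶ v` vanish, because `y` is killed; the others reach `w` through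
  -- `v`.
  have h2 : ∀ a, exponent ϖ Γ (c a) v = exponent ϖ Γ (c a) w + exponent ϖ Γ w v → Y a = 0 := by
    intro a ha
    have h3 := (H.coverRep_map_apply c (fun a => M.E (c a)) q.toPath Y a).symm.trans
      (congrFun h1 a)
    rw [hq, if_pos ha] at h3
    exact h3
  refine ⟨M.coverHom c v Y, (M.coverHom c v Y).2, ?_⟩
  rw [M.coe_coverHom, map_sum]
  refine Eq.trans ?_ (congrArg Subtype.val hY)
  rw [M.coe_coverHom]
  refine Finset.sum_congr rfl fun a _ => ?_
  rcases H.dichotomy_in hadj (c a) with h3 | h3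
  · rw [h2 a h3]
    simp
  · exact H.map_map h3 _

end Covers

/-! ### Linear independence in families -/

section LinearIndependence

variable {k : Type*} [Field k] {V : Type*} [AddCommGroup V] [Module k V] {m : ℕ}

theorem linearIndependent_of_det_ne_zero (L : V →ₗ[k] Fin m → k) (y : Fin m → V)
    (h : (Matrix.of fun q p => L (y q) p).det ≠ 0) : LinearIndependent k y := by
  refine LinearIndependent.of_comp L ?_
  have h1 := Matrix.linearIndependent_rows_iff_isUnit.2
    ((Matrix.isUnit_iff_isUnit_det _).2 (isUnit_iff_ne_zero.2 h))
  exact h1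

theorem exists_det_eq_one {y : Fin m → V} (h : LinearIndependent k y) :
    ∃ L : V →ₗ[k] Fin m → k, (Matrix.of fun q p => L (y q) p).det = 1 := by
  obtain ⟨L, hL⟩ := LinearMap.exists_leftInverse_of_injective (Fintype.linearCombination k y)
    (LinearMap.ker_eq_bot.2 h.fintypeLinearCombination_injective)
  refine ⟨L, ?_⟩
  have h1 : (Matrix.of fun q p => L (y q) p) = 1 := by
    ext q p
    have h2 := congrArg (fun g => g (Pi.single q 1) p) hL
    simp only [LinearMap.comp_apply, Fintype.linearCombination_apply_single, one_smul,
      LinearMap.id_apply] at h2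
    rw [Matrix.of_apply, h2, Matrix.one_apply, Pi.single_apply]
    simp [eq_comm]
  rw [h1, Matrix.det_one]

/-- Linear independence of the members of a line of families is a generic condition. -/
theorem finite_setOf_not_linearIndependent {y z : Fin m → V} {t₀ : k}
    (h : LinearIndependent k fun q => y q + t₀ • z q) :
    {t : k | ¬ LinearIndependent k fun q => y q + t • z q}.Finite := by
  obtain ⟨L, hL⟩ := exists_det_eq_one h
  -- A minor along the line is a polynomial in `t` with value one at `t₀`.
  let A : Matrix (Fin m) (Fin m) (Polynomial k) := Matrix.of fun q p =>
    Polynomial.C (L (y q) p) + Polynomial.X * Polynomial.C (L (z q) p)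
  have hA : ∀ t : k, A.det.eval t = (Matrix.of fun q p => L (y q + t • z q) p).det := by
    intro t
    rw [← Polynomial.coe_evalRingHom, RingHom.map_det]
    congr 1
    ext q p
    simp [A]
    ring
  have h0 : A.det ≠ 0 := by
    intro h0
    have h1 := hA t₀
    rw [hL, h0] at h1
    simp at h1
  refine (Polynomial.finite_setOfPred_isRoot h0).subset fun t ht => ?_
  by_contra hne
  refine ht (linearIndependent_of_det_ne_zero L _ ?_)
  rw [← hA]
  exact hne

/-- Rank bounds become conditions on subfamilies, hence on minors. -/
theorem le_finrank_span_range_iff [FiniteDimensional k V] {n : ℕ} (y : Fin n → V) :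
    m ≤ Module.finrank k (Submodule.span k (Set.range y)) ↔
      ∃ a : Fin m → Fin n, LinearIndependent k (y ∘ a) := by
  constructor
  · intro h
    obtain ⟨g, hg, -, hli⟩ := Submodule.exists_fun_fin_finrank_span_eq k (Set.range y)
    choose a ha using hg
    refine ⟨a ∘ Fin.castLE h, ?_⟩
    have h1 : y ∘ a ∘ Fin.castLE h = g ∘ Fin.castLE h := funext fun i => ha _
    rw [h1]
    exact hli.comp _ (Fin.castLE_injective h)
  · rintro ⟨a, ha⟩
    have h1 := finrank_span_eq_card ha
    rw [Fintype.card_fin] at h1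
    rw [← h1]
    exact Submodule.finrank_mono (Submodule.span_mono (Set.range_comp_subset_range _ _))

end LinearIndependence

/-! ### Lines of points and semicontinuity of ranks in the Zariski topology. -/

section Topology

set_option linter.unusedSectionVars false

variable {R : Type u} [CommRing R] [IsDomain R] [IsDiscreteValuationRing R]
  {K : Type w} [Field K] [Algebra R K] [IsFractionRing R K] {ϖ : R} {d : ℕ} {ι : Type x}
  {Γ : Configuration R K d ι} {I : ι → Set ι} {r : ℕ}

/-- A power of `ϖ` above the minimal one induces zero, so stability under the maps `f i j` alone
yields a point. -/
theorem baseChange_mulMap (hϖ : Irreducible ϖ) (hd : 0 < d) {i j : ι} {k : ℤ}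
    (h : piPow K ϖ k • Γ.L i ≤ Γ.L j) (y : Γ.Lbar i) :
    (mulMap (piPow K ϖ k) h).baseChange (Kappa R) y = smallF ϖ Γ i j y ∨
      (mulMap (piPow K ϖ k) h).baseChange (Kappa R) y = 0 := by
  obtain ⟨y, rfl⟩ := exists_mk_eq (Γ.L i) y
  have hle := (piPow_smul_mem_iff Γ hϖ hd i j k).1 (smul_le_iff.1 h)
  rw [LinearMap.baseChange_tmul]
  rcases hle.eq_or_lt with rfl | hlt
  · left
    rw [smallF_mk Γ hϖ hd]
    rfl
  · right
    rw [mk_eq_zero_iff hϖ]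
    refine ⟨piPow K ϖ (k - 1) • (y : Fin d → K),
      (piPow_smul_mem_iff Γ hϖ hd i j _).2 (by omega) y y.2, ?_⟩
    rw [← piPow_one_smul, smul_smul, ← piPow_add hϖ, add_sub_cancel]
    rfl

/-- The point given by a stable family of subspaces. -/
noncomputable def SpecialFiber.ofIsStable (hϖ : Irreducible ϖ) (hd : 0 < d)
    (U : ∀ i, Submodule (Kappa R) (Γ.Lbar i)) (hU : IsStable (smallF ϖ Γ) U)
    (hr : ∀ i, Module.finrank (Kappa R) (U i) = r) : SpecialFiber ϖ Γ r where
  E := U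
  finrank_eq := hr
  compat i j k h y hy := by
    rcases baseChange_mulMap hϖ hd h y with h1 | h1 <;> rw [h1]
    · exact hU i j y hy
    · exact Submodule.zero_mem _

/-- The subspaces of the point `N` have as bases the members at `t` of the lines through `y`
with direction `z`. -/
def IsLine (y z : ∀ i, Fin r → Γ.Lbar i) (t : Kappa R) (N : SpecialFiber ϖ Γ r) : Prop :=
  ∀ i, LinearIndependent (Kappa R) (fun a => y i a + t • z i a) ∧
    Submodule.span (Kappa R) (Set.range fun a => y i a + t • z i a) = N.E i

/-- The framed point given by a member of a line. -/
noncomputable def IsLine.framed {y z : ∀ i, Fin r → Γ.Lbar i} {t : Kappa R}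
    {N : SpecialFiber ϖ Γ r} (h : IsLine y z t N) : SpecialFiber.Framed ϖ Γ r where
  point := N
  basis i := (Module.Basis.span (h i).1).map (LinearEquiv.ofEq _ _ (h i).2)

theorem IsLine.coord_framed {y z : ∀ i, Fin r → Γ.Lbar i} {t : Kappa R}
    {N : SpecialFiber ϖ Γ r} (h : IsLine y z t N) (s) :
    h.framed.coord s = s.2.2 (y s.1 s.2.1) + t * s.2.2 (z s.1 s.2.1) := by
  have h1 : (h.framed.basis s.1 s.2.1 : Γ.Lbar s.1) = y s.1 s.2.1 + t • z s.1 s.2.1 :=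
    congrArg Subtype.val (Module.Basis.span_apply (h s.1).1 s.2.1)
  rw [SpecialFiber.Framed.coord]
  refine (congrArg s.2.2 h1).trans ?_
  rw [map_add, map_smul, smul_eq_mul]

/-- A line which meets an open subset lies generically in it. -/
theorem IsLine.finite_setOf_notMem {y z : ∀ i, Fin r → Γ.Lbar i} {t₀ : Kappa R}
    {N₀ : SpecialFiber ϖ Γ r} (h : IsLine y z t₀ N₀) {W : Set (SpecialFiber ϖ Γ r)}
    (hW : IsOpen W) (hN : N₀ ∈ W) :
    {t : Kappa R | ∃ N : SpecialFiber ϖ Γ r, IsLine y z t N ∧ N ∉ W}.Finite := by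
  obtain ⟨S, hS⟩ := (SpecialFiber.isClosed_iff Wᶜ).1 hW.isClosed_compl
  have h1 := (not_congr (hS h.framed)).1 (fun h2 => h2 hN)
  push Not at h1
  obtain ⟨p, hp, hp0⟩ := h1
  -- An equation of the complement of `W` that fails at `N₀`, restricted to the line.
  let Q : Polynomial (Kappa R) := MvPolynomial.aeval (fun s =>
    Polynomial.C (s.2.2 (y s.1 s.2.1)) + Polynomial.X * Polynomial.C (s.2.2 (z s.1 s.2.1))) p
  have hQ : ∀ {t} {N : SpecialFiber ϖ Γ r} (h : IsLine y z t N), Q.eval t = MvPolynomial.eval h.framed.coord p := by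
    intro t N h
    have h2 : h.framed.coord = fun s => Polynomial.eval t (Polynomial.C (s.2.2 (y s.1 s.2.1)) +
        Polynomial.X * Polynomial.C (s.2.2 (z s.1 s.2.1))) := by
      funext s
      rw [h.coord_framed]
      simp
      ring
    rw [h2]
    simp only [Q, ← Polynomial.coe_evalRingHom]
    rw [MvPolynomial.aeval_def, MvPolynomial.hom_eval₂, MvPolynomial.eval, MvPolynomial.coe_eval₂Hom]
    congr 1
    ext
    simp
  have hQ0 : Q ≠ 0 := by
    intro hQ0
    rw [← hQ h, hQ0] at hp0
    simp at hp0
  refine (Polynomial.finite_setOfPred_isRoot hQ0).subset ?_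
  rintro t ⟨N, hN, hNW⟩
  exact (hQ hN).trans ((hS hN.framed).1 hNW p hp)

/-- The equations are all minors of size `m + 1`, taken in all linear coordinates `L` on the target.
-/
theorem isClosed_setOf_rankVector_le (u v : ι) (m : ℕ) :
    IsClosed {N : SpecialFiber ϖ Γ r | N.rankVector u v ≤ m} := by
  rw [SpecialFiber.isClosed_iff]
  let D : (Fin (m + 1) → Fin r) → (Γ.Lbar v →ₗ[Kappa R] Fin (m + 1) → Kappa R) →
      MvPolynomial (Σ i, Fin r × Module.Dual (Kappa R) (Γ.Lbar i)) (Kappa R) := fun a L =>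
    (Matrix.of fun q p => MvPolynomial.X ⟨u, a q,
      LinearMap.proj p ∘ₗ L ∘ₗ smallF ϖ Γ u v⟩ : Matrix (Fin (m + 1)) (Fin (m + 1)) _).det
  refine ⟨Set.range fun s : _ × _ => D s.1 s.2, fun b => ?_⟩
  let y : Fin r → Γ.Lbar v := fun a => smallF ϖ Γ u v (b.basis u a)
  have hD : ∀ a L, MvPolynomial.eval b.coord (D a L) =
      (Matrix.of fun q p => L ((y ∘ a) q) p).det := by
    intro a L
    rw [RingHom.map_det]
    congr 1
    ext q p
    simp [SpecialFiber.Framed.coord, y]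
  have hspan : (b.point.E u).map (smallF ϖ Γ u v) = Submodule.span (Kappa R) (Set.range y) := by
    have h1 : y = smallF ϖ Γ u v ∘ (b.point.E u).subtype ∘ b.basis u := rfl
    rw [h1, Set.range_comp, Set.range_comp, ← Submodule.map_span, ← Submodule.map_span,
      (b.basis u).span_eq, Submodule.map_top, Submodule.range_subtype]
  have hrank : b.point.rankVector u v =
      Module.finrank (Kappa R) (Submodule.span (Kappa R) (Set.range y)) := by
    rw [SpecialFiber.rankVector, hspan]
  rw [Set.mem_ofPred_eq, hrank, ← not_lt, ← Nat.succ_le_iff, le_finrank_span_range_iff]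
  constructor
  · rintro h _ ⟨⟨a, L⟩, rfl⟩
    by_contra hne
    rw [hD] at hne
    exact h ⟨a, linearIndependent_of_det_ne_zero L _ hne⟩
  · rintro h ⟨a, ha⟩
    obtain ⟨L, hL⟩ := exists_det_eq_one ha
    have h1 := h _ ⟨⟨a, L⟩, rfl⟩
    rw [hD, hL] at h1
    exact one_ne_zero h1

end Topology

/-! ### Strata and irreducible components -/

/-- The vectors `y` are chosen before `t`, so the deformed subspaces have bases that move along one
line. -/
theorem exists_basis_map {k V : Type*} [Field k] [AddCommGroup V] [Module k V]
    (U : Submodule k V) [FiniteDimensional k U] {r : ℕ} (hr : Module.finrank k U = r)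
    (φ : V →ₗ[k] V) : ∃ y : Fin r → V, ∀ t : k,
      Function.Injective (LinearMap.id + t • φ : V →ₗ[k] V) →
      LinearIndependent k (fun a => y a + t • φ (y a)) ∧
        Submodule.span k (Set.range fun a => y a + t • φ (y a)) =
          U.map (LinearMap.id + t • φ : V →ₗ[k] V) := by
  let B : Module.Basis (Fin r) k U := Module.finBasisOfFinrankEq _ _ hr
  refine ⟨fun a => B a, fun t ht => ?_⟩
  have h1 : (fun a => (B a : V) + t • φ (B a)) =
      (LinearMap.id + t • φ : V →ₗ[k] V) ∘ U.subtype ∘ B := rfl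
  rw [h1]
  refine ⟨(B.linearIndependent.map' U.subtype (Submodule.ker_subtype _)).map' _
    (LinearMap.ker_eq_bot.2 ht), ?_⟩
  rw [Set.range_comp, Set.range_comp, ← Submodule.map_span, ← Submodule.map_span, B.span_eq,
    Submodule.map_top, Submodule.range_subtype]

section Components

set_option linter.unusedSectionVars false

variable {R : Type u} [CommRing R] [IsDomain R] [IsDiscreteValuationRing R]
  {K : Type w} [Field K] [Algebra R K] [IsFractionRing R K] {ϖ : R} {d : ℕ} {ι : Type x}
  {Γ : Configuration R K d ι} {I : ι → Set ι} {r : ℕ} {t : ι → ℕ}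

theorem isOpen_setOf_le_rankVector (u v : ι) (m : ℕ) :
    IsOpen {N : SpecialFiber ϖ Γ r | m ≤ N.rankVector u v} := by
  rcases m with - | m
  · simp
  · have h := (isClosed_setOf_rankVector_le (ϖ := ϖ) (Γ := Γ) (r := r) u v m).isOpen_compl
    convert h using 1
    ext N
    simp

theorem isClosed_setOf_rankVector_le_rankVector (N : SpecialFiber ϖ Γ r) :
    IsClosed {M : SpecialFiber ϖ Γ r | M.rankVector ≤ N.rankVector} := by
  have h : {M : SpecialFiber ϖ Γ r | M.rankVector ≤ N.rankVector} =
      ⋂ u, ⋂ v, {M : SpecialFiber ϖ Γ r | M.rankVector u v ≤ N.rankVector u v} := by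
    ext M
    simp [Pi.le_def]
  rw [h]
  exact isClosed_iInter fun u => isClosed_iInter fun v => isClosed_setOf_rankVector_le u v _

theorem isOpen_setOf_rankVector_le_rankVector [Finite ι] (M : SpecialFiber ϖ Γ r) :
    IsOpen {N : SpecialFiber ϖ Γ r | M.rankVector ≤ N.rankVector} := by
  have h : {N : SpecialFiber ϖ Γ r | M.rankVector ≤ N.rankVector} =
      ⋂ u, ⋂ v, {N : SpecialFiber ϖ Γ r | M.rankVector u v ≤ N.rankVector u v} := by
    ext N
    simp [Pi.le_def]
  rw [h]
  exact isOpen_iInter_of_finite fun u => isOpen_iInter_of_finite fun v =>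
    isOpen_setOf_le_rankVector u v _

theorem SpecialFiber.rankVector_le (M : SpecialFiber ϖ Γ r) (u v : ι) : M.rankVector u v ≤ r :=
  (Submodule.finrank_map_le _ _).trans (M.finrank_eq u).le

theorem SpecialFiber.isProjective_iff_isExact [Finite ι]
    (H : IsLinked (smallF ϖ Γ) (exponent ϖ Γ) I) {M : SpecialFiber ϖ Γ r} :
    M.IsProjective ↔ IsExact (smallF ϖ Γ) I M.E := by
  refine ⟨fun hM => hM.isExact H, fun hM => ?_⟩
  obtain ⟨t, e, he⟩ := H.exists_isAdapted M.isStable hM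
  exact he.isProjective H

theorem SpecialFiber.IsProjective.exists_isAdapted [Finite ι]
    (H : IsLinked (smallF ϖ Γ) (exponent ϖ Γ) I) {M : SpecialFiber ϖ Γ r}
    (hM : M.IsProjective) :
    ∃ (t : ι → ℕ) (e : ∀ s : (Σ u, Fin (t u)), Γ.Lbar s.1), IsAdapted (smallF ϖ Γ) M.E e :=
  H.exists_isAdapted M.isStable (hM.isExact H)

/-- A point which is not exact is a specialization of points with larger rank vectors. -/
theorem SpecialFiber.mem_closure_of_not_isExact [Infinite (Kappa R)] [Finite ι]
    (hϖ : Irreducible ϖ) (hd : 0 < d) (H : IsLinked (smallF ϖ Γ) (exponent ϖ Γ) I)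
    {M : SpecialFiber ϖ Γ r} (hM : ¬ IsExact (smallF ϖ Γ) I M.E) :
    M ∈ closure {N : SpecialFiber ϖ Γ r | M.rankVector < N.rankVector} := by
  obtain ⟨φ, c, a, b, hinj, hst, hrk⟩ := H.exists_deformation M.isStable M.finrank_eq hM
  choose y hy using fun i => exists_basis_map (M.E i) (M.finrank_eq i) (φ i)
  have h0 : IsLine y (fun i a => φ i (y i a)) 0 M := by
    intro i
    have h1 := hy i 0 (hinj 0 (by simp) i)
    rw [zero_smul, add_zero, Submodule.map_id] at h1
    exact h1
  refine mem_closure_iff.2 fun W hW hMW => ?_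
  have hfin := h0.finite_setOf_notMem (hW.inter (isOpen_setOf_rankVector_le_rankVector M))
    ⟨hMW, le_refl M.rankVector⟩
  have hc : {s : Kappa R | 1 + s * c = 0}.Finite := by
    refine Set.Subsingleton.finite fun s hs s' hs' => ?_
    have hc0 : c ≠ 0 := by
      rintro rfl
      simp at hs
    exact mul_right_cancel₀ hc0 (add_left_cancel (hs.trans hs'.symm))
  -- Generic parameters stay in `W`, lose no rank and keep the maps injective; `s ≠ 0` makes one
  -- rank strictly larger.
  obtain ⟨s, hs⟩ := (hfin.union (hc.union (Set.finite_singleton 0))).exists_notMem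
  simp only [Set.mem_union, not_or] at hs
  obtain ⟨hs1, hs2, hs3⟩ := hs
  have hfr : ∀ i, Module.finrank (Kappa R)
      ((M.E i).map (LinearMap.id + s • φ i : Γ.Lbar i →ₗ[Kappa R] Γ.Lbar i)) = r := by
    intro i
    rw [← (hy i s (hinj s hs2 i)).2, finrank_span_eq_card (hy i s (hinj s hs2 i)).1,
      Fintype.card_fin]
  have hN : IsLine y (fun i a => φ i (y i a)) s (ofIsStable hϖ hd _ (hst s) hfr) :=
    fun i => hy i s (hinj s hs2 i)
  have hNW : ofIsStable hϖ hd _ (hst s) hfr ∈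
      W ∩ {N : SpecialFiber ϖ Γ r | M.rankVector ≤ N.rankVector} := by
    by_contra h
    exact hs1 ⟨_, hN, h⟩
  have hlt : M.rankVector < (ofIsStable hϖ hd _ (hst s) hfr).rankVector :=
    lt_of_le_not_ge hNW.2 fun h => (hrk s hs3).not_ge (h a b)
  exact ⟨_, hNW.1, hlt⟩

/-- The projective points are dense. -/
theorem SpecialFiber.dense_setOf_isProjective [Infinite (Kappa R)] [Finite ι]
    (hϖ : Irreducible ϖ) (hd : 0 < d) (H : IsLinked (smallF ϖ Γ) (exponent ϖ Γ) I) :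
    Dense {M : SpecialFiber ϖ Γ r | M.IsProjective} := by
  have := Fintype.ofFinite ι
  have hlt : ∀ {f g : ι → ι → ℕ}, f < g → ∑ u, ∑ v, f u v < ∑ u, ∑ v, g u v := by
    intro f g h
    obtain ⟨h1, u, h2⟩ := Pi.lt_def.1 h
    obtain ⟨h3, v, h4⟩ := Pi.lt_def.1 h2
    exact Finset.sum_lt_sum (fun u _ => Finset.sum_le_sum fun v _ => h1 u v)
      ⟨u, Finset.mem_univ _, Finset.sum_lt_sum (fun v _ => h3 v) ⟨v, Finset.mem_univ _, h4⟩⟩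
  have hle : ∀ N : SpecialFiber ϖ Γ r,
      ∑ u, ∑ v, N.rankVector u v ≤ ∑ _u : ι, ∑ _v : ι, r := fun N =>
    Finset.sum_le_sum fun u _ => Finset.sum_le_sum fun v _ => N.rankVector_le u v
  intro M
  -- Ranks are at most `r`, so the total deficit is a natural number that drops in each deformation.
  induction hm : (∑ _u : ι, ∑ _v : ι, r) - ∑ u, ∑ v, M.rankVector u v using
    Nat.strong_induction_on generalizing M with
  | _ m ih =>
    by_cases hM : IsExact (smallF ϖ Γ) I M.E
    · exact subset_closure ((isProjective_iff_isExact H).2 hM)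
    · refine closure_minimal (fun N hN => ?_) isClosed_closure
        (mem_closure_of_not_isExact hϖ hd H hM)
      have h1 := hlt hN
      have h2 := hle N
      exact ih _ (by omega) N rfl

theorem IsAdapted.rankVector_eq [Finite ι] {M N : SpecialFiber ϖ Γ r}
    {e e' : ∀ s : (Σ u, Fin (t u)), Γ.Lbar s.1} (he : IsAdapted (smallF ϖ Γ) M.E e)
    (he' : IsAdapted (smallF ϖ Γ) N.E e') (H : IsLinked (smallF ϖ Γ) (exponent ϖ Γ) I) :
    M.rankVector = N.rankVector := by
  have := Fintype.ofFinite ι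
  exact funext fun u => funext fun v => (he.rank_eq H u v).trans (he'.rank_eq H u v).symm

theorem IsAdapted.of_rankVector_le [Finite ι] {M N : SpecialFiber ϖ Γ r}
    {e : ∀ s : (Σ u, Fin (t u)), Γ.Lbar s.1} (he : IsAdapted (smallF ϖ Γ) M.E e)
    (H : IsLinked (smallF ϖ Γ) (exponent ϖ Γ) I) (h : M.rankVector ≤ N.rankVector) :
    ∃ e' : ∀ s : (Σ u, Fin (t u)), Γ.Lbar s.1, IsAdapted (smallF ϖ Γ) N.E e' :=
  he.of_rank_le H M.isStable N.isStable M.finrank_eq N.finrank_eq h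

/-- The projective points are those with maximal rank vectors. -/
theorem SpecialFiber.isProjective_iff_maximal [Infinite (Kappa R)] [Finite ι]
    (hϖ : Irreducible ϖ) (hd : 0 < d) (H : IsLinked (smallF ϖ Γ) (exponent ϖ Γ) I)
    (M : SpecialFiber ϖ Γ r) : M.IsProjective ↔
      Maximal (· ∈ Set.range (rankVector (ϖ := ϖ) (Γ := Γ) (r := r))) M.rankVector := by
  constructor
  · intro hM
    refine ⟨⟨M, rfl⟩, ?_⟩
    rintro _ ⟨N, rfl⟩ hle
    obtain ⟨t, e, he⟩ := hM.exists_isAdapted H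
    obtain ⟨e', he'⟩ := he.of_rankVector_le H hle
    exact (he.rankVector_eq he' H).ge
  · intro hM
    by_contra hne
    rw [isProjective_iff_isExact H] at hne
    obtain ⟨N, hN⟩ := closure_nonempty_iff.1 ⟨M, mem_closure_of_not_isExact hϖ hd H hne⟩
    exact hN.not_ge (hM.2 ⟨N, rfl⟩ hN.le)

theorem IsAdapted.stratum_eq [Finite ι] {M : SpecialFiber ϖ Γ r}
    {e : ∀ s : (Σ u, Fin (t u)), Γ.Lbar s.1} (he : IsAdapted (smallF ϖ Γ) M.E e)
    (H : IsLinked (smallF ϖ Γ) (exponent ϖ Γ) I) :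
    M.stratum = {N : SpecialFiber ϖ Γ r |
      ∃ e' : ∀ s : (Σ u, Fin (t u)), Γ.Lbar s.1, IsAdapted (smallF ϖ Γ) N.E e'} := by
  ext N
  constructor
  · rintro ⟨α⟩
    exact he.of_iso H α.symm
  · rintro ⟨e', he'⟩
    exact he'.nonempty_iso he H

theorem SpecialFiber.mem_stratum (M : SpecialFiber ϖ Γ r) : M ∈ M.stratum := ⟨Iso.refl _⟩

/-- The points with generators of a given type form an irreducible set. -/
theorem isPreirreducible_setOf_isAdapted [Infinite (Kappa R)] [Finite ι]
    (hϖ : Irreducible ϖ) (hd : 0 < d) (H : IsLinked (smallF ϖ Γ) (exponent ϖ Γ) I)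
    (t : ι → ℕ) : IsPreirreducible {N : SpecialFiber ϖ Γ r |
      ∃ e : ∀ s : (Σ u, Fin (t u)), Γ.Lbar s.1, IsAdapted (smallF ϖ Γ) N.E e} := by
  have := Fintype.ofFinite ι
  rintro W₁ W₂ hW₁ hW₂ ⟨N₁, ⟨e₁, he₁⟩, hN₁⟩ ⟨N₂, ⟨e₂, he₂⟩, hN₂⟩
  have hcard : ∀ _v : ι, Fintype.card (Fin r) = Fintype.card (Σ u, Fin (t u)) := by
    intro v
    simp only [Fintype.card_fin, Fintype.card_sigma]
    rw [← he₁.finrank_eq v, N₁.finrank_eq]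
  let q : ∀ _v : ι, Fin r ≃ (Σ u, Fin (t u)) := fun v => Fintype.equivOfCardEq (hcard v)
  let y : ∀ i, Fin r → Γ.Lbar i := fun i a => smallF ϖ Γ _ i (e₁ (q i a))
  let z : ∀ i, Fin r → Γ.Lbar i := fun i a => smallF ϖ Γ _ i (e₂ (q i a) - e₁ (q i a))
  -- The line joins the generators rather than the bases of the subspaces, so that every member with
  -- independent images has the same type.
  let e : Kappa R → ∀ s : (Σ u, Fin (t u)), Γ.Lbar s.1 := fun c s => e₁ s + c • (e₂ s - e₁ s)
  have hyz : ∀ c i, (fun a => y i a + c • z i a) = (fun s => smallF ϖ Γ s.1 i (e c s)) ∘ q i := by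
    intro c i
    funext a
    simp only [Function.comp_apply, e, y, z]
    rw [map_add, map_smul]
  have hline : ∀ {c} {N : SpecialFiber ϖ Γ r}, IsLine y z c N ↔ IsAdapted (smallF ϖ Γ) N.E (e c) := by
    intro c N
    simp only [IsLine, hyz]
    constructor
    · intro h
      refine ⟨fun i => (linearIndependent_equiv (q i)).1 (h i).1, fun i => ?_⟩
      rw [← (h i).2, (q i).surjective.range_comp]
    · intro h i
      refine ⟨(linearIndependent_equiv (q i)).2 (h.indep i), ?_⟩
      rw [← h.span i, (q i).surjective.range_comp]
  have h0 : e 0 = e₁ := by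
    funext s
    simp [e]
  have h1 : e 1 = e₂ := by
    funext s
    simp [e]
  have hl₁ : IsLine y z 0 N₁ := hline.2 (h0 ▸ he₁)
  have hl₂ : IsLine y z 1 N₂ := hline.2 (h1 ▸ he₂)
  have hfin : (⋃ i, {c : Kappa R |
      ¬ LinearIndependent (Kappa R) fun a => y i a + c • z i a}).Finite :=
    Set.finite_iUnion fun i => finite_setOf_not_linearIndependent (hl₁ i).1
  obtain ⟨c, hc⟩ := (hfin.union ((hl₁.finite_setOf_notMem hW₁ hN₁).union
    (hl₂.finite_setOf_notMem hW₂ hN₂))).exists_notMem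
  simp only [Set.mem_union, Set.mem_iUnion, not_or, not_exists] at hc
  obtain ⟨hc0, hc1, hc2⟩ := hc
  have hli : ∀ i, LinearIndependent (Kappa R) fun a => y i a + c • z i a := fun i =>
    not_not.1 (hc0 i)
  let U : ∀ i, Submodule (Kappa R) (Γ.Lbar i) := fun i =>
    Submodule.span (Kappa R) (Set.range fun s => smallF ϖ Γ s.1 i (e c s))
  have hU : IsStable (smallF ϖ Γ) U := by
    intro i j
    change U i ≤ (U j).comap (smallF ϖ Γ i j)
    refine Submodule.span_le.2 ?_
    rintro _ ⟨s, rfl⟩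
    simp only [Submodule.comap_coe, Set.mem_preimage, SetLike.mem_coe]
    rw [H.map_map_ite]
    split_ifs
    · exact Submodule.subset_span ⟨s, rfl⟩
    · exact Submodule.zero_mem _
  have hind : ∀ i, LinearIndependent (Kappa R) fun s => smallF ϖ Γ s.1 i (e c s) := by
    intro i
    have h2 := hli i
    rw [hyz] at h2
    exact (linearIndependent_equiv (q i)).1 h2
  let N : SpecialFiber ϖ Γ r := SpecialFiber.ofIsStable hϖ hd U hU fun i =>
    (finrank_span_eq_card (hind i)).trans ((hcard i).symm.trans (Fintype.card_fin r))
  have hN : IsAdapted (smallF ϖ Γ) N.E (e c) := ⟨hind, fun i => rfl⟩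
  refine ⟨N, ⟨e c, hN⟩, ?_, ?_⟩
  · by_contra h
    exact hc1 ⟨N, hline.2 hN, h⟩
  · by_contra h
    exact hc2 ⟨N, hline.2 hN, h⟩

namespace SpecialFiber

theorem IsProjective.isIrreducible_stratum [Infinite (Kappa R)] [Finite ι]
    (hϖ : Irreducible ϖ) (hd : 0 < d) (H : IsLinked (smallF ϖ Γ) (exponent ϖ Γ) I)
    {M : SpecialFiber ϖ Γ r} (hM : M.IsProjective) : IsIrreducible M.stratum := by
  obtain ⟨t, e, he⟩ := hM.exists_isAdapted H
  refine ⟨⟨M, M.mem_stratum⟩, ?_⟩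
  rw [he.stratum_eq H]
  exact isPreirreducible_setOf_isAdapted hϖ hd H t

/-- A projective point in the closure of the stratum of a projective point lies in it. -/
theorem IsProjective.mem_stratum_of_mem_closure [Finite ι]
    (H : IsLinked (smallF ϖ Γ) (exponent ϖ Γ) I) {M N : SpecialFiber ϖ Γ r}
    (hM : M.IsProjective) (hN : N.IsProjective) (h : M ∈ closure N.stratum) :
    N ∈ M.stratum := by
  obtain ⟨t, e, he⟩ := hM.exists_isAdapted H
  obtain ⟨t', e', he'⟩ := hN.exists_isAdapted H
  -- The rank vector is constant on the stratum of `N` and can only drop in its closure.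
  have hle : M.rankVector ≤ N.rankVector := by
    refine closure_minimal (fun N' hN' => ?_) (isClosed_setOf_rankVector_le_rankVector N) h
    rw [he'.stratum_eq H] at hN'
    obtain ⟨e'', he''⟩ := hN'
    exact (he''.rankVector_eq he' H).le
  rw [he.stratum_eq H]
  exact he.of_rankVector_le H hle

theorem stratum_eq_of_mem {M N : SpecialFiber ϖ Γ r} (h : N ∈ M.stratum) :
    N.stratum = M.stratum := by
  obtain ⟨α⟩ := h
  ext N'
  exact ⟨fun ⟨β⟩ => ⟨β ≪≫ α⟩, fun ⟨β⟩ => ⟨β ≪≫ α.symm⟩⟩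

/-- A projective stratum is determined by the numbers `t u`, which are at most `r`. -/
theorem finite_setOf_stratum [Finite ι] (H : IsLinked (smallF ϖ Γ) (exponent ϖ Γ) I) :
    {Z : Set (SpecialFiber ϖ Γ r) | ∃ M : SpecialFiber ϖ Γ r, M.IsProjective ∧
      Z = closure M.stratum}.Finite := by
  have := Fintype.ofFinite ι
  refine (Set.finite_range fun t : ι → Fin (r + 1) => closure {N : SpecialFiber ϖ Γ r |
    ∃ e : ∀ s : (Σ u, Fin (t u : ℕ)), Γ.Lbar s.1, IsAdapted (smallF ϖ Γ) N.E e}).subset ?_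
  rintro _ ⟨M, hM, rfl⟩
  obtain ⟨t, e, he⟩ := hM.exists_isAdapted H
  have ht : ∀ u, t u ≤ r := by
    intro u
    rw [← M.finrank_eq u, he.finrank_eq u]
    exact Finset.single_le_sum (fun _ _ => Nat.zero_le _) (Finset.mem_univ u)
  exact ⟨fun u => ⟨t u, Nat.lt_succ_of_le (ht u)⟩, (congrArg closure (he.stratum_eq H)).symm⟩

theorem irreducibleComponents_eq [Infinite (Kappa R)] [Finite ι]
    (hϖ : Irreducible ϖ) (hd : 0 < d) (H : IsLinked (smallF ϖ Γ) (exponent ϖ Γ) I) :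
    irreducibleComponents (SpecialFiber ϖ Γ r) =
      {Z | ∃ M : SpecialFiber ϖ Γ r, M.IsProjective ∧ Z = closure M.stratum} := by
  have hfin := finite_setOf_stratum (r := r) H
  have hcover : ∀ Z : Set (SpecialFiber ϖ Γ r), IsIrreducible Z →
      ∃ M : SpecialFiber ϖ Γ r, M.IsProjective ∧ Z ⊆ closure M.stratum := by
    intro Z hZ
    -- By density, the finitely many closures cover the space, so an irreducible set lies in one of
    -- them.
    obtain ⟨_, hY, hZY⟩ := isIrreducible_iff_sUnion_isClosed.1 hZ hfin.toFinset
      (fun Y hY => by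
        obtain ⟨M, -, rfl⟩ := hfin.mem_toFinset.1 hY
        exact isClosed_closure)
      (fun N _ => by
        rw [hfin.coe_toFinset, Set.sUnion_eq_biUnion]
        refine closure_minimal (fun M hM => ?_) (hfin.isClosed_biUnion ?_)
          (dense_setOf_isProjective hϖ hd H N)
        · exact Set.mem_biUnion ⟨M, hM, rfl⟩ (subset_closure M.mem_stratum)
        · rintro _ ⟨M, -, rfl⟩
          exact isClosed_closure)
    obtain ⟨M, hM, rfl⟩ := hfin.mem_toFinset.1 hY
    exact ⟨M, hM, hZY⟩
  ext Z
  constructor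
  · intro hZ
    obtain ⟨M, hM, hZM⟩ := hcover Z hZ.1
    exact ⟨M, hM, hZM.antisymm (hZ.2 (hM.isIrreducible_stratum hϖ hd H).closure hZM)⟩
  · rintro ⟨M, hM, rfl⟩
    refine ⟨(hM.isIrreducible_stratum hϖ hd H).closure, fun Y hY hMY => ?_⟩
    obtain ⟨N, hN, hYN⟩ := hcover Y hY
    have h := hM.mem_stratum_of_mem_closure H hN (hYN (hMY (subset_closure M.mem_stratum)))
    rw [← stratum_eq_of_mem h]
    exact hYN

end SpecialFiber

end Components

end LinkedGrassmannian

theorem mainTheorem4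
    {R : Type u} [CommRing R] [IsDomain R] [IsDiscreteValuationRing R]
    [IsAlgClosed (IsLocalRing.ResidueField R)]
    {K : Type w} [Field K] [Algebra R K] [IsFractionRing R K]
    (ϖ : R) (hϖ : Irreducible ϖ)
    {d r : ℕ} (hr : 0 < r) (hrd : r < d)
    {ι : Type x} [Finite ι] (Γ : LinkedGrassmannian.Configuration R K d ι)
    (hΓ : LinkedGrassmannian.IsLocallyWeaklyIndependent ϖ Γ) :
    Dense {M : LinkedGrassmannian.SpecialFiber ϖ Γ r | M.IsProjective} ∧
    (∀ M : LinkedGrassmannian.SpecialFiber ϖ Γ r,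
      M.IsProjective ↔
        Maximal (· ∈ Set.range
          (LinkedGrassmannian.SpecialFiber.rankVector (ϖ := ϖ) (Γ := Γ) (r := r)))
          M.rankVector) ∧
    irreducibleComponents (LinkedGrassmannian.SpecialFiber ϖ Γ r) =
      {Z | ∃ M : LinkedGrassmannian.SpecialFiber ϖ Γ r, M.IsProjective ∧ Z = closure M.stratum} ∧
    (∀ M N : LinkedGrassmannian.SpecialFiber ϖ Γ r, M.IsProjective → N.IsProjective →
      closure M.stratum = closure N.stratum → Nonempty (M.rep ≅ N.rep)) := by
  have hd : 0 < d := hr.trans hrd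
  -- Being algebraically closed, `κ` is infinite, so a line has members outside any finite set of
  -- bad parameters.
  have : Infinite (LinkedGrassmannian.Kappa R) := inferInstance
  obtain ⟨I, H⟩ := hΓ.exists_isLinked Γ hϖ hd
  refine ⟨LinkedGrassmannian.SpecialFiber.dense_setOf_isProjective hϖ hd H,
    LinkedGrassmannian.SpecialFiber.isProjective_iff_maximal hϖ hd H,
    LinkedGrassmannian.SpecialFiber.irreducibleComponents_eq hϖ hd H, ?_⟩
  intro M N hM hN h
  obtain ⟨α⟩ := hM.mem_stratum_of_mem_closure H hN (h ▸ subset_closure M.mem_stratum)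
  exact ⟨α.symm⟩
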